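/- **Setting.** A *quasi-uncertain hybrid system* $\mathcal H$ consists of: a finite set $\mathcal J$ of modes and a set $\mathcal E\subset\mathcal J\times\mathcal J$ of directed edges; for each $j\in\mathcal J$ a compact $n_j$-dimensional manifold with boundary $D_j\subset\mathbb R^{n_j}$ (of which only compactness and $D_j=\overline{\operatorname{int}D_j}$ will be used), a compact set $\Theta_j\subset\mathbb R^{m_j}$, a Borel probability measure $\mu_{\theta_j}$ on $\Theta_j$, and a vector field $\tilde f_j:D_j\times\Theta_j\to\mathbb R^{n_j}$ that is Lipschitz in all variables; for each $(j,k)\in\mathcal E$ a closed guard $G_{(j,k)}\subset\partial D_j$ and a continuously differentiable injection (reset map) $R_{(j,k)}:G_{(j,k)}\to D_k$. It is assumed that $G_{(i,j)}\cap G_{(i,k)}=\emptyset$ for $(i,j),(i,k)\in\mathcal E$ with $j\ne k$, and that $R_{(i,j)}(G_{(i,j)})\cap G_{(j,k)}=\emptyset$ for $(i,j),(j,k)\in\mathcal E$ with $(j,k)\neq(i,j)$. An execution enters a mode $j$ at a time $t$ at a point of $D_j$, draws a parameter value $\theta$ from $\mu_{\theta_j}$ (a point of its support), and follows an absolutely continuous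 solution in $D_j$ of $\dot\gamma=\tilde f_j(\gamma,\theta)$ until the first time it is in a guard $G_{(j,k)}$ of mode $j$ (possibly at once); there the state is instantaneously reset by $R_{(j,k)}$ and the execution continues in mode $k$ in the same way. It is assumed that $\mathcal H$ has no Zeno execution, i.e. no execution has infinitely many transitions in a finite time interval. Let $T>0$, $\mathcal T=[0,T]$, and for each $j$ let $X_{(T,j)}\subset D_j$ be compact and disjoint from every guard of mode $j$. For compact $K$ let $\mathcal M_+(K)$ be the set of nonnegative (finite) Radon measures on $K$, and $\langle\mu,v\rangle=\int v\,d\mu$. Let $\lambda_j$ be Lebesgue measure restricted to $D_j$. Write $\mathcal C^1(\mathcal T\times D_j\times\Theta_j)$ for the restrictions of $C^1$ functions on $\mathbb R\times\mathbb R^{n_j}\times\mathbb R^{m_j}$, and $\mathcal L_{f_j}v=\partial_t v+\langle\nabla_x v,\tilde f_j\rangle$ for $v$ in this space. **Primal $(P)$.** Maximize $\sum_{j}\langle\mu_{0_j},1\rangle$ over $\mu_j\in\mathcal M_+(\mathcal T\times D_j\times\Theta_j)$, $\mu_{0_j},\hat\mu_{0_j}\in\mathcal M_+(D_j)$, $\mu_{T_j}\in\mathcal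 M_+(X_{(T,j)}\times\Theta_j)$ $(j\in\mathcal J)$ and $\mu_{G_{(j,k)}}\in\mathcal M_+(\mathcal T\times G_{(j,k)}\times\Theta_j)$ $((j,k)\in\mathcal E)$ subject to $$\langle\mu_{s_j},v\rangle+\langle\mu_j,\mathcal L_{f_j}v\rangle=\langle\mu_{f_j},v\rangle\quad\forall v\in\mathcal C^1(\mathcal T\times D_j\times\Theta_j),\ \forall j,$$ $$\mu_{0_j}+\hat\mu_{0_j}=\lambda_j\ \ \forall j,\qquad \sum_j\langle\mu_{T_j},1\rangle=\sum_j\langle\mu_{0_j},1\rangle,$$ where $$\mu_{s_j}=\delta_0\otimes\mu_{0_j}\otimes\mu_{\theta_j}+\sum_{i:(i,j)\in\mathcal E}R_{(i,j)}^*\big(\pi_{(t,x)}^*\mu_{G_{(i,j)}}\big)\otimes\mu_{\theta_j},\qquad \mu_{f_j}=\delta_T\otimes\mu_{T_j}+\sum_{k:(j,k)\in\mathcal E}\mu_{G_{(j,k)}};$$ here $^*$ denotes push-forward, $\pi_{(t,x)}(t,x,\theta)=(t,x)$, and $R_{(i,j)}$ acts on $(t,x)$ as the identity in $t$. **Dual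 $(D)$.** Minimize $\sum_j\langle\lambda_j,w_j\rangle$ over $v_j\in\mathcal C^1(\mathcal T\times D_j\times\Theta_j)$, $w_j\in\mathcal C(D_j)$ $(j\in\mathcal J)$ and $q\in\mathbb R$ subject to, for all $j\in\mathcal J$, $$\begin{aligned} &w_j(x)\ge 0 && \forall x\in D_j,\\ &v_j(T,x,\theta)+q\ge 0 && \forall (x,\theta)\in X_{(T,j)}\times\Theta_j,\\ &-\mathcal L_{f_j}v_j(t,x,\theta)\ge 0 && \forall (t,x,\theta)\in\mathcal T\times D_j\times\Theta_j,\\ &w_j(x)-\textstyle\int v_j(0,x,\theta)\,d\mu_{\theta_j}(\theta)-q\ge 1 && \forall x\in D_j,\\ &v_j(t,x,\theta)-\textstyle\int v_k(t,R_{(j,k)}(x),\theta')\,d\mu_{\theta_k}(\theta')\ge 0 && \forall (t,x,\theta)\in\mathcal T\times G_{(j,k)}\times\Theta_j,\ (j,k)\in\mathcal E. \end{aligned}$$ **Lemma.** $(P)$ and $(D)$ have the same optimal value, and this value is finite: there is $c\in\mathbb R$ with $\sup(P)=c=\inf(D)$. That is, there is no duality gap. -/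

import Mathlib

open MeasureTheory Set
open scoped NNReal

noncomputable section

/-- `MPlus K`: the nonnegative Radon measures on a compact set `K` of a Euclidean space (or a product
of such), i.e. the finite Borel measures of the ambient space that give no mass to the complement
of `K`. -/
def MPlus {α : Type*} [MeasurableSpace α] (K : Set α) : Set (Measure α) :=
  {μ | IsFiniteMeasure μ ∧ μ Kᶜ = 0}

/-- A quasi-uncertain hybrid system with finite set of modes `J`. -/
structure QuasiUncertainHybridSystem (J : Type*) [Fintype J] [DecidableEq J] where
  /-- directed edges -/
  E : Finset (J × J)
  /-- dimension of the state in each mode -/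
  n : J → ℕ
  /-- dimension of the uncertain parameter in each mode -/
  m : J → ℕ
  /-- domains -/
  D : ∀ j, Set (EuclideanSpace ℝ (Fin (n j)))
  isCompact_D : ∀ j, IsCompact (D j)
  /-- A compact `n`-dimensional manifold with boundary in `ℝⁿ` is the closure of its interior; this
  is the only consequence of being such a manifold that is retained. -/
  closure_interior_D : ∀ j, closure (interior (D j)) = D j
  /-- parameter sets -/
  Θ : ∀ j, Set (EuclideanSpace ℝ (Fin (m j)))
  isCompact_Θ : ∀ j, IsCompact (Θ j)
  /-- laws of the uncertain parameters, Borel probability measures on `Θ j` -/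
  μΘ : ∀ j, Measure (EuclideanSpace ℝ (Fin (m j)))
  isProbabilityMeasure_μΘ : ∀ j, IsProbabilityMeasure (μΘ j)
  μΘ_mem : ∀ j, μΘ j ∈ MPlus (Θ j)
  /-- vector fields; only the values on `D j × Θ j` matter -/
  f : ∀ j, EuclideanSpace ℝ (Fin (n j)) × EuclideanSpace ℝ (Fin (m j)) →
    EuclideanSpace ℝ (Fin (n j))
  lipschitz_f : ∀ j, ∃ K : ℝ≥0, LipschitzOnWith K (f j) (D j ×ˢ Θ j)
  /-- guards; `G j k` matters only if `(j, k)` is an edge -/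
  G : ∀ j : J, J → Set (EuclideanSpace ℝ (Fin (n j)))
  isClosed_G : ∀ j k, (j, k) ∈ E → IsClosed (G j k)
  G_subset : ∀ j k, (j, k) ∈ E → G j k ⊆ frontier (D j)
  /-- reset maps; only the values of `R j k` on `G j k` for edges `(j, k)` matter -/
  R : ∀ j k : J, EuclideanSpace ℝ (Fin (n j)) → EuclideanSpace ℝ (Fin (n k))
  contDiffOn_R : ∀ j k, (j, k) ∈ E → ContDiffOn ℝ 1 (R j k) (G j k)
  injOn_R : ∀ j k, (j, k) ∈ E → InjOn (R j k) (G j k)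
  mapsTo_R : ∀ j k, (j, k) ∈ E → MapsTo (R j k) (G j k) (D k)
  /-- the image of a reset map meets no guard of another edge -/
  reset_disjoint : ∀ i j k, (i, j) ∈ E → (j, k) ∈ E → (j, k) ≠ (i, j) →
    Disjoint (R i j '' G i j) (G j k)
  /-- guards of the same mode are mutually exclusive -/
  guard_disjoint : ∀ i j k, (i, j) ∈ E → (i, k) ∈ E → j ≠ k → Disjoint (G i j) (G i k)

namespace QuasiUncertainHybridSystem

variable {J : Type*} [Fintype J] [DecidableEq J]

/-- State space `ℝ^{n_j}` containing the domain of mode `j`. -/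
abbrev X (H : QuasiUncertainHybridSystem J) (j : J) : Type := EuclideanSpace ℝ (Fin (H.n j))

/-- Parameter space `ℝ^{m_j}` containing `Θ_j`. -/
abbrev Y (H : QuasiUncertainHybridSystem J) (j : J) : Type := EuclideanSpace ℝ (Fin (H.m j))

/-! ### Executions -/

/-- `γ` is an absolutely continuous solution in `D j`, on the time interval `[a, b]`, of
`γ' = f_j(γ, θ)`. -/
def IsArc (H : QuasiUncertainHybridSystem J) (j : J) (θ : H.Y j) (a b : ℝ) (γ : ℝ → H.X j) :
    Prop :=
  AbsolutelyContinuousOnInterval γ a b ∧ (∀ s ∈ Icc a b, γ s ∈ H.D j) ∧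
    ∀ᵐ s ∂(volume.restrict (Icc a b)), HasDerivAt γ (H.f j (γ s, θ)) s

/-- An execution of the system with infinitely many mode transitions: for every `n`, mode `mode n`
is entered at time `τ n`, the value `θ n` of the parameter is drawn from (the support of) its law, the state follows `γ n` on
`[τ n, τ (n+1)]`, and `τ (n+1)` is the first time at which it is in a guard of the mode; there it is
reset to mode `mode (n+1)`. -/
structure InfiniteExecution (H : QuasiUncertainHybridSystem J) where
  mode : ℕ → J
  τ : ℕ → ℝ
  θ : ∀ n, H.Y (mode n)
  γ : ∀ n, ℝ → H.X (mode n)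
  τ_zero : τ 0 = 0
  τ_le : ∀ n, τ n ≤ τ (n + 1)
  θ_mem : ∀ n, θ n ∈ (H.μΘ (mode n)).support
  isArc : ∀ n, H.IsArc (mode n) (θ n) (τ n) (τ (n + 1)) (γ n)
  not_mem_guard : ∀ n, ∀ s ∈ Ico (τ n) (τ (n + 1)), ∀ k, (mode n, k) ∈ H.E →
    γ n s ∉ H.G (mode n) k
  edge : ∀ n, (mode n, mode (n + 1)) ∈ H.E
  mem_guard : ∀ n, γ n (τ (n + 1)) ∈ H.G (mode n) (mode (n + 1))
  reset : ∀ n, γ (n + 1) (τ (n + 1)) = H.R (mode n) (mode (n + 1)) (γ n (τ (n + 1)))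

/-- No Zeno executions: no execution makes infinitely many transitions in a finite time interval. -/
def NoZeno (H : QuasiUncertainHybridSystem J) : Prop :=
  ¬ ∃ e : H.InfiniteExecution, ∃ B : ℝ, ∀ n, e.τ n ≤ B

/-! ### The two linear programs -/

/-- `𝒯 × D_j × Θ_j` with `𝒯 = [0, T]`. -/
def Ω (H : QuasiUncertainHybridSystem J) (T : ℝ) (j : J) : Set (ℝ × H.X j × H.Y j) :=
  Icc 0 T ×ˢ H.D j ×ˢ H.Θ j

/-- The operator `𝓛_f v = ∂v/∂t + ⟨∇ₓ v, f_j⟩`. Functions in `C¹(𝒯 × D_j × Θ_j)` are represented by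
`C¹` functions on the ambient space, of which only the restriction to `𝒯 × D_j × Θ_j` matters: as
`D_j` is the closure of its interior, that restriction determines `𝓛_f v` there (`0 < T`). -/
def liouvilleOp (H : QuasiUncertainHybridSystem J) (j : J) (v : ℝ × H.X j × H.Y j → ℝ) :
    ℝ × H.X j × H.Y j → ℝ := fun z =>
  deriv (fun s => v (s, z.2.1, z.2.2)) z.1 +
    fderiv ℝ (fun x => v (z.1, x, z.2.2)) z.2.1 (H.f j (z.2.1, z.2.2))

/-- The variables of the primal program; `μG j k` is used only if `(j, k)` is an edge. -/
structure PrimalVar (H : QuasiUncertainHybridSystem J) where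
  /-- occupation measures -/
  μ : ∀ j, Measure (ℝ × H.X j × H.Y j)
  /-- initial measures -/
  μ0 : ∀ j, Measure (H.X j)
  /-- terminal measures -/
  μT : ∀ j, Measure (H.X j × H.Y j)
  /-- slack measures -/
  μ0hat : ∀ j, Measure (H.X j)
  /-- guard measures -/
  μG : ∀ j : J, J → Measure (ℝ × H.X j × H.Y j)

/-- The starting measure
`μ_{s_j} = δ₀ ⊗ μ_{0_j} ⊗ μ_{θ_j} + ∑_{(i,j) ∈ E} R_{(i,j)}^* (π_{(t,x)}^* μ_{G_{(i,j)}}) ⊗ μ_{θ_j}`,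
where the reset map acts as the identity on the time component. -/
def startMeasure (H : QuasiUncertainHybridSystem J) (p : H.PrimalVar) (j : J) :
    Measure (ℝ × H.X j × H.Y j) :=
  (Measure.dirac (0 : ℝ)).prod ((p.μ0 j).prod (H.μΘ j)) +
    ∑ i ∈ Finset.univ.filter (fun i => (i, j) ∈ H.E),
      ((((p.μG i j).map (fun z => (z.1, z.2.1))).map
        (fun y : ℝ × H.X i => (y.1, H.R i j y.2))).prod (H.μΘ j)).map MeasurableEquiv.prodAssoc

/-- The final measure `μ_{f_j} = δ_T ⊗ μ_{T_j} + ∑_{(j,k) ∈ E} μ_{G_{(j,k)}}`. -/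
def finalMeasure (H : QuasiUncertainHybridSystem J) (T : ℝ) (p : H.PrimalVar) (j : J) :
    Measure (ℝ × H.X j × H.Y j) :=
  (Measure.dirac T).prod (p.μT j) +
    ∑ k ∈ Finset.univ.filter (fun k => (j, k) ∈ H.E), p.μG j k

/-- Feasibility for the primal program with horizon `T` and terminal sets `XT`. The Liouville
equation `μ_{s_j} + 𝓛_f' μ_j = μ_{f_j}` is tested against `C¹(𝒯 × D_j × Θ_j)`. -/
structure PrimalFeasible (H : QuasiUncertainHybridSystem J) (T : ℝ) (XT : ∀ j, Set (H.X j))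
    (p : H.PrimalVar) : Prop where
  mem_μ : ∀ j, p.μ j ∈ MPlus (H.Ω T j)
  mem_μ0 : ∀ j, p.μ0 j ∈ MPlus (H.D j)
  mem_μT : ∀ j, p.μT j ∈ MPlus (XT j ×ˢ H.Θ j)
  mem_μ0hat : ∀ j, p.μ0hat j ∈ MPlus (H.D j)
  mem_μG : ∀ j k, (j, k) ∈ H.E → p.μG j k ∈ MPlus (Icc 0 T ×ˢ H.G j k ×ˢ H.Θ j)
  liouville : ∀ j, ∀ v : ℝ × H.X j × H.Y j → ℝ, ContDiff ℝ 1 v →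
    ∫ z, v z ∂(H.startMeasure p j) + ∫ z, H.liouvilleOp j v z ∂(p.μ j) =
      ∫ z, v z ∂(H.finalMeasure T p j)
  slack : ∀ j, p.μ0 j + p.μ0hat j = volume.restrict (H.D j)
  mass : ∑ j, ∫ _z, (1 : ℝ) ∂(p.μT j) = ∑ j, ∫ _x, (1 : ℝ) ∂(p.μ0 j)

/-- The optimal value of the primal program: the supremum of `∑ⱼ ⟨μ_{0_j}, 1⟩`. -/
def primalValue (H : QuasiUncertainHybridSystem J) (T : ℝ) (XT : ∀ j, Set (H.X j)) : EReal :=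
  ⨆ (p : H.PrimalVar) (_ : H.PrimalFeasible T XT p), ((∑ j, ∫ _x, (1 : ℝ) ∂(p.μ0 j) : ℝ) : EReal)

/-- The variables of the dual program. -/
structure DualVar (H : QuasiUncertainHybridSystem J) where
  v : ∀ j, ℝ × H.X j × H.Y j → ℝ
  w : ∀ j, H.X j → ℝ
  q : ℝ

/-- Feasibility for the dual program with horizon `T` and terminal sets `XT`. -/
structure DualFeasible (H : QuasiUncertainHybridSystem J) (T : ℝ) (XT : ∀ j, Set (H.X j))
    (d : H.DualVar) : Prop where
  contDiff_v : ∀ j, ContDiff ℝ 1 (d.v j)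
  continuousOn_w : ∀ j, ContinuousOn (d.w j) (H.D j)
  w_nonneg : ∀ j, ∀ x ∈ H.D j, 0 ≤ d.w j x
  terminal : ∀ j, ∀ x ∈ XT j, ∀ θ ∈ H.Θ j, 0 ≤ d.v j (T, x, θ) + d.q
  flow : ∀ j, ∀ z ∈ H.Ω T j, 0 ≤ -H.liouvilleOp j (d.v j) z
  initial : ∀ j, ∀ x ∈ H.D j, 1 ≤ d.w j x - ∫ θ, d.v j (0, x, θ) ∂(H.μΘ j) - d.q
  guard : ∀ j k, (j, k) ∈ H.E → ∀ t ∈ Icc 0 T, ∀ x ∈ H.G j k, ∀ θ ∈ H.Θ j,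
    0 ≤ d.v j (t, x, θ) - ∫ θ', d.v k (t, H.R j k x, θ') ∂(H.μΘ k)

/-- The optimal value of the dual program: the infimum of `∑ⱼ ⟨λ_j, w_j⟩`. -/
def dualValue (H : QuasiUncertainHybridSystem J) (T : ℝ) (XT : ∀ j, Set (H.X j)) : EReal :=
  ⨅ (d : H.DualVar) (_ : H.DualFeasible T XT d), ((∑ j, ∫ x in H.D j, d.w j x : ℝ) : EReal)

end QuasiUncertainHybridSystem

end

open MeasureTheory Set
open scoped NNReal

noncomputable section

/-! The dual program minimizes a linear objective over C¹ functions, continuous functions and a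
number, subject to finitely many families of inequalities between continuous functions on compact
sets. It is treated as a conic program whose multipliers are the primal measures.

Strong duality comes from a Slater point. If the constraints can all be satisfied strictly, the
image of that point is an order unit of the constraint space. The M. Riesz extension theorem then
gives a positive functional that reproduces the objective and takes the optimal value on the
right-hand side (`exists_positive_dual_of_isGLB`); no closedness of a cone is needed. By
Riesz–Markov–Kakutani the functional is a family of measures. Testing it against each dual variable
in turn recovers the Liouville equations, the slack identity and the mass balance, so these measures
are primal feasible with objective equal to the dual infimum. Weak duality is integration of the
dual inequalities.

The Slater point is where the absence of Zeno executions enters (`exists_strictly_feasible`). The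
guard inequality must be strict, so a function is needed that drops strictly at every reset. If
arbitrarily long chains of instantaneous resets existed, compactness would give an infinite one,
which is a Zeno execution at time 0. Hence chain lengths are bounded, and
`exists_contDiff_lt_of_jumpSet_eq_empty` builds C¹ functions `g j` decreasing along chains.
Subtracting a large multiple of time makes the flow inequality strict without affecting resets,
which preserve time; `q` and `w` are then chosen large. -/

/-! ### Abstract conic duality and Riesz representation -/

/-- Conic linear programming duality with attainment of the dual multiplier, under a Slater
condition: if `A d₀` is an order unit, the infimum of `ℓ` over `{d | b ≤ A d}` is `Λ b` for a
positive functional `Λ` with `Λ ∘ A = ℓ`. -/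
theorem exists_positive_dual_of_isGLB {V Y : Type*} [AddCommGroup V] [Module ℝ V]
    [AddCommGroup Y] [PartialOrder Y] [IsOrderedAddMonoid Y] [Module ℝ Y] [PosSMulMono ℝ Y]
    (A : V →ₗ[ℝ] Y) (b : Y) (ℓ : V →ₗ[ℝ] ℝ) (d₀ : V) (hd₀ : ∀ y, ∃ c : ℝ, 0 ≤ y + c • A d₀)
    {p : ℝ} (hne : ∃ d, b ≤ A d) (hp : IsGLB (ℓ '' {d | b ≤ A d}) p) :
    ∃ Λ : Y →ₗ[ℝ] ℝ, (∀ y, 0 ≤ y → 0 ≤ Λ y) ∧ (∀ d, Λ (A d) = ℓ d) ∧ Λ b = p := by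
  -- Moving along such a direction preserves feasibility, so a negative slope would push the
  -- objective below `p`.
  have recession : ∀ d, 0 ≤ A d → 0 ≤ ℓ d := by
    intro d hd
    obtain ⟨d₁, h₁⟩ := hne
    by_contra! hneg
    obtain ⟨r, hr⟩ := exists_nat_gt ((ℓ d₁ - p) / (-ℓ d))
    have hfeas : b ≤ A (d₁ + (r : ℝ) • d) := by
      rw [map_add, map_smul]
      exact le_add_of_le_of_nonneg h₁ (smul_nonneg r.cast_nonneg hd)
    have hle : p ≤ ℓ (d₁ + (r : ℝ) • d) := hp.1 ⟨_, hfeas, rfl⟩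
    rw [map_add, map_smul, smul_eq_mul] at hle
    rw [div_lt_iff₀ (by linarith)] at hr
    linarith
  -- Homogenization: for `s > 0` rescale to a feasible point; for `s < 0` add `-s` times a nearly
  -- optimal point and use the recession inequality; `s = 0` is that inequality itself.
  have key : ∀ (d : V) (s : ℝ), 0 ≤ A d - s • b → 0 ≤ ℓ d - s * p := by
    intro d s h
    rcases lt_trichotomy s 0 with hs | rfl | hs
    · refine le_of_forall_pos_le_add fun ε hε => ?_
      obtain ⟨_, ⟨d', hd', rfl⟩, hlt⟩ :=
        (isGLB_lt_iff hp).1 (show p < p + ε / (-s) by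
          have := div_pos hε (neg_pos.2 hs); linarith)
      have h' : 0 ≤ A (d + (-s) • d') := by
        have e : A (d + (-s) • d') = (A d - s • b) + (-s) • (A d' - b) := by
          rw [map_add, map_smul]; module
        rw [e]
        exact add_nonneg h (smul_nonneg (by linarith) (sub_nonneg.2 hd'))
      have := recession _ h'
      rw [map_add, map_smul, smul_eq_mul] at this
      have h2 : (-s) * ℓ d' ≤ (-s) * (p + ε / (-s)) :=
        mul_le_mul_of_nonneg_left hlt.le (by linarith)
      have h3 : (-s) * (p + ε / (-s)) = -s * p + ε := by
        rw [mul_add, mul_div_cancel₀ _ (by linarith : -s ≠ 0)]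
      linarith
    · simpa using recession d (by simpa using h)
    · have hfeas : b ≤ A (s⁻¹ • d) := by
        have := smul_nonneg (inv_nonneg.2 hs.le) h
        rw [smul_sub, smul_smul, inv_mul_cancel₀ hs.ne', one_smul] at this
        rw [map_smul]
        exact sub_nonneg.1 this
      have hle : p ≤ ℓ (s⁻¹ • d) := hp.1 ⟨_, hfeas, rfl⟩
      rw [map_smul, smul_eq_mul, inv_mul_eq_div, le_div_iff₀ hs] at hle
      linarith
  let A' : V × ℝ →ₗ[ℝ] Y := A.comp (LinearMap.fst ℝ V ℝ) -
    (LinearMap.toSpanSingleton ℝ Y b).comp (LinearMap.snd ℝ V ℝ)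
  let ℓ' : V × ℝ →ₗ[ℝ] ℝ := ℓ.comp (LinearMap.fst ℝ V ℝ) - p • LinearMap.snd ℝ V ℝ
  have hA' : ∀ d s, A' (d, s) = A d - s • b := fun d s => by simp [A']
  have hℓ' : ∀ d s, ℓ' (d, s) = ℓ d - s * p := fun d s => by simp [ℓ', mul_comm]
  have key' : ∀ x, 0 ≤ A' x → 0 ≤ ℓ' x := fun x hx => by
    obtain ⟨d, s⟩ := x
    rw [hℓ']; exact key d s (by rwa [hA'] at hx)
  -- Positivity applied to `x` and `-x` makes `ℓ'` factor through the range of `A'`, so the choice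
  -- of the linear section `σ` below is immaterial.
  have hker : ∀ x, A' x = 0 → ℓ' x = 0 := fun x hx => by
    refine le_antisymm ?_ (key' x hx.ge)
    have := key' (-x) (by rw [map_neg, hx, neg_zero])
    rw [map_neg] at this
    linarith
  obtain ⟨σ, hσ⟩ := A'.rangeRestrict.exists_rightInverse_of_surjective A'.range_rangeRestrict
  have hσ' : ∀ x : LinearMap.range A', A' (σ x) = x := fun x =>
    congrArg Subtype.val (LinearMap.congr_fun hσ x)
  obtain ⟨Λ, hΛ, hpos⟩ := riesz_extension (PointedCone.positive ℝ Y)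
    (⟨LinearMap.range A', ℓ'.comp σ⟩ : Y →ₗ.[ℝ] ℝ)
    (fun x hx => key' (σ x) (by rw [hσ' x]; exact hx))
    -- Cofinality of the range, required by the extension theorem; this is the only use of the order
    -- unit.
    (fun y => by
      obtain ⟨c, hc⟩ := hd₀ y
      refine ⟨⟨A' (c • d₀, 0), LinearMap.mem_range_self _ _⟩, ?_⟩
      have e : A' (c • d₀, 0) = c • A d₀ := by rw [hA', map_smul, zero_smul, sub_zero]
      change 0 ≤ A' (c • d₀, 0) + y
      rwa [e, add_comm])
  have hΛ' : ∀ x, Λ (A' x) = ℓ' x := fun x => by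
    have h := hΛ ⟨A' x, LinearMap.mem_range_self _ _⟩
    refine h.trans ?_
    change ℓ' (σ _) = ℓ' x
    rw [← sub_eq_zero, ← map_sub]
    apply hker
    rw [map_sub, hσ', sub_self]
  refine ⟨Λ, fun y hy => hpos y hy, fun d => ?_, ?_⟩
  · simpa [hA', hℓ'] using hΛ' (d, 0)
  -- The pair `(0, -1)` is sent to `b` by `A'` and to `p` by `ℓ'`.
  · simpa [hA', hℓ'] using hΛ' (0, -1)

/-- Riesz–Markov–Kakutani for a compact subset of an ambient space. -/
theorem exists_mem_MPlus_integral_eq {α : Type*} [TopologicalSpace α] [T2Space α]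
    [MeasurableSpace α] [BorelSpace α] {S : Set α} (hS : IsCompact S)
    (Λ : C(S, ℝ) →ₗ[ℝ] ℝ) (hΛ : ∀ g, 0 ≤ g → 0 ≤ Λ g) :
    ∃ μ ∈ MPlus S, ∀ (g : C(S, ℝ)) (F : α → ℝ), (∀ x : S, F x = g x) → ∫ x, F x ∂μ = Λ g := by
  have := isCompact_iff_compactSpace.1 hS
  let toC : CompactlySupportedContinuousMap S ℝ →ₗ[ℝ] C(S, ℝ) :=
    { toFun := fun f => f.toContinuousMap
      map_add' := fun _ _ => rfl
      map_smul' := fun _ _ => rfl }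
  let Λ' : CompactlySupportedContinuousMap S ℝ →ₚ[ℝ] ℝ :=
    PositiveLinearMap.mk₀ (Λ.comp toC) fun f hf => hΛ _ hf
  have hemb : MeasurableEmbedding ((↑) : S → α) := MeasurableEmbedding.subtype_coe hS.measurableSet
  refine ⟨(RealRMK.rieszMeasure Λ').map (↑), ⟨?_, ?_⟩, fun g F hF => ?_⟩
  · have : IsFiniteMeasure (RealRMK.rieszMeasure Λ') := ⟨isCompact_univ.measure_lt_top⟩
    infer_instance
  · rw [hemb.map_apply]
    simp
  · rw [hemb.integral_map]
    simp_rw [hF]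
    exact RealRMK.integral_rieszMeasure Λ' (CompactlySupportedContinuousMap.continuousMapEquiv g)

/-! ### Chains of instantaneous resets -/

section Jumps

variable {J : Type*} {X : J → Type*}

/-- The points of `X j` from which `n` successive jumps along edges are possible. -/
def jumpSet (E : Finset (J × J)) (G : ∀ j : J, J → Set (X j)) (R : ∀ j k : J, X j → X k) :
    ℕ → ∀ j, Set (X j)
  | 0, _ => univ
  | n + 1, j => {x | ∃ k, (j, k) ∈ E ∧ x ∈ G j k ∧ R j k x ∈ jumpSet E G R n k}

variable {E : Finset (J × J)} {G : ∀ j : J, J → Set (X j)} {R : ∀ j k : J, X j → X k}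

theorem jumpSet_succ_subset (n : ℕ) : ∀ j, jumpSet E G R (n + 1) j ⊆ jumpSet E G R n j := by
  induction n with
  | zero => exact fun j => subset_univ _
  | succ n ih =>
    rintro j x ⟨k, hk, hx, hR⟩
    exact ⟨k, hk, hx, ih k hR⟩

theorem jumpSet_antitone (j : J) : Antitone fun n => jumpSet E G R n j :=
  antitone_nat_of_succ_le fun n => jumpSet_succ_subset n j

theorem jumpSet_mono {G' : ∀ j : J, J → Set (X j)} (h : ∀ j k, G' j k ⊆ G j k) (n : ℕ) :
    ∀ j, jumpSet E G' R n j ⊆ jumpSet E G R n j := by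
  induction n with
  | zero => exact fun j => subset_univ _
  | succ n ih =>
    rintro j x ⟨k, hk, hx, hR⟩
    exact ⟨k, hk, h j k hx, ih k hR⟩

variable [Finite J] [∀ j, TopologicalSpace (X j)]

theorem isClosed_jumpSet (hG : ∀ j k, (j, k) ∈ E → IsClosed (G j k))
    (hR : ∀ j k, (j, k) ∈ E → ContinuousOn (R j k) (G j k)) (n : ℕ) :
    ∀ j, IsClosed (jumpSet E G R n j) := by
  induction n with
  | zero => exact fun j => isClosed_univ
  | succ n ih =>
    intro j
    have : jumpSet E G R (n + 1) j =
        ⋃ k ∈ {k | (j, k) ∈ E}, G j k ∩ R j k ⁻¹' jumpSet E G R n k := by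
      ext x; simp [jumpSet, and_left_comm]
    rw [this]
    exact (toFinite _).isClosed_biUnion fun k hk =>
      (hR j k hk).preimage_isClosed_of_isClosed (hG j k hk) (ih k)

/-- The index starts at one because zero jumps impose no condition; one jump already confines the
point to a finite union of compact guards. -/
theorem isCompact_jumpSet_succ [∀ j, T2Space (X j)] (hG : ∀ j k, (j, k) ∈ E → IsCompact (G j k))
    (hR : ∀ j k, (j, k) ∈ E → ContinuousOn (R j k) (G j k)) (n : ℕ) (j : J) :
    IsCompact (jumpSet E G R (n + 1) j) := by
  have hU : IsCompact (⋃ k ∈ {k | (j, k) ∈ E}, G j k) :=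
    (toFinite _).isCompact_biUnion fun k hk => hG j k hk
  refine hU.of_isClosed_subset (isClosed_jumpSet (fun j k h => (hG j k h).isClosed) hR _ j) ?_
  rintro x ⟨k, hk, hx, -⟩
  exact mem_biUnion hk hx

/-- If arbitrarily many successive jumps are possible, then so are infinitely many. -/
theorem exists_infinite_jumps [∀ j, T2Space (X j)] (hG : ∀ j k, (j, k) ∈ E → IsCompact (G j k))
    (hR : ∀ j k, (j, k) ∈ E → ContinuousOn (R j k) (G j k))
    (h : ∀ n, ∃ j, (jumpSet E G R n j).Nonempty) :
    ∃ s : ℕ → Σ j, X j, ∀ n, ((s n).1, (s (n + 1)).1) ∈ E ∧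
      (s n).2 ∈ G (s n).1 (s (n + 1)).1 ∧ (s (n + 1)).2 = R (s n).1 (s (n + 1)).1 (s n).2 := by
  have := Fintype.ofFinite J
  -- A point admitting chains of every length has a successor with the same property: if each mode
  -- `k` failed at some length `N k`, a chain one longer than the maximum of `N` would be
  -- impossible.
  have step : ∀ x : {p : Σ j, X j // ∀ n, p.2 ∈ jumpSet E G R n p.1},
      ∃ y : {p : Σ j, X j // ∀ n, p.2 ∈ jumpSet E G R n p.1}, (x.1.1, y.1.1) ∈ E ∧
        x.1.2 ∈ G x.1.1 y.1.1 ∧ y.1.2 = R x.1.1 y.1.1 x.1.2 := by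
    rintro ⟨⟨j, x⟩, hx⟩
    by_contra! hcon
    have : ∀ k, ∃ n, ¬ ((j, k) ∈ E ∧ x ∈ G j k ∧ R j k x ∈ jumpSet E G R n k) := by
      intro k
      by_contra! hk
      exact hcon ⟨⟨k, R j k x⟩, fun n => (hk n).2.2⟩ (hk 0).1 (hk 0).2.1 rfl
    choose N hN using this
    obtain ⟨k, hk, hxG, hxR⟩ := hx (Finset.univ.sup N + 1)
    exact hN k ⟨hk, hxG, jumpSet_antitone k (Finset.le_sup (Finset.mem_univ k)) hxR⟩
  -- Finiteness of the modes fixes one mode with chains of every length; Cantor's intersection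
  -- theorem then fixes one point.
  have start : ∃ p : Σ j, X j, ∀ n, p.2 ∈ jumpSet E G R n p.1 := by
    have : ∃ j, ∀ n, (jumpSet E G R n j).Nonempty := by
      by_contra! hcon
      choose N hN using hcon
      obtain ⟨j, hj⟩ := h (Finset.univ.sup N)
      exact (hj.mono (jumpSet_antitone j (Finset.le_sup (Finset.mem_univ j)))).ne_empty (hN j)
    obtain ⟨j, hj⟩ := this
    obtain ⟨x, hx⟩ := IsCompact.nonempty_iInter_of_sequence_nonempty_isCompact_isClosed
      (fun n => jumpSet E G R (n + 1) j) (fun n => jumpSet_succ_subset _ j) (fun n => hj _)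
      (isCompact_jumpSet_succ hG hR 0 j)
      (fun n => (isCompact_jumpSet_succ hG hR n j).isClosed)
    exact ⟨⟨j, x⟩, fun n => jumpSet_succ_subset n j (mem_iInter.1 hx n)⟩
  choose next hnext using step
  obtain ⟨p, hp⟩ := start
  refine ⟨fun n => (next^[n] ⟨p, hp⟩).1, fun n => ?_⟩
  beta_reduce
  rw [show next^[n + 1] ⟨p, hp⟩ = next (next^[n] ⟨p, hp⟩) from Function.iterate_succ_apply' ..]
  exact hnext _

end Jumps

/-- If the number of possible successive jumps is bounded, there is a `C¹` function that strictly
decreases at each jump. -/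
theorem exists_contDiff_lt_of_jumpSet_eq_empty {J : Type*} [Finite J] {X : J → Type*}
    [∀ j, NormedAddCommGroup (X j)] [∀ j, NormedSpace ℝ (X j)] [∀ j, FiniteDimensional ℝ (X j)]
    {E : Finset (J × J)} {R : ∀ j k : J, X j → X k} (n : ℕ) :
    ∀ (G : ∀ j : J, J → Set (X j)), (∀ j k, (j, k) ∈ E → IsCompact (G j k)) →
      (∀ j k, (j, k) ∈ E → ContinuousOn (R j k) (G j k)) →
      (∀ j, jumpSet E G R (n + 1) j = ∅) →
      ∃ g : ∀ j, X j → ℝ, (∀ j, ContDiff ℝ 1 (g j)) ∧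
        ∀ j k, (j, k) ∈ E → ∀ x ∈ G j k, g k (R j k x) < g j x := by
  induction n with
  | zero =>
    intro G _ _ h
    refine ⟨fun _ _ => 0, fun _ => contDiff_const, fun j k hjk x hx => ?_⟩
    exact absurd (show x ∈ jumpSet E G R (0 + 1) j from ⟨k, hjk, hx, mem_univ _⟩)
      (by rw [h j]; exact notMem_empty _)
  | succ n ih =>
    intro G hG hR h
    -- Points starting a chain of the maximal length `n + 1` are never reset images, since the
    -- preceding reset would lengthen the chain. A smooth bump can thus be 1 near them and 0 on all
    -- reset images.
    have hφ : ∀ j, ∃ φ : X j → ℝ, ContDiff ℝ 1 φ ∧ (∀ i, (i, j) ∈ E → ∀ x ∈ G i j,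
        φ (R i j x) = 0) ∧ (∀ x, 0 ≤ φ x) ∧
        ∃ U : Set (X j), IsOpen U ∧ jumpSet E G R (n + 1) j ⊆ U ∧ ∀ x ∈ U, φ x = 1 := by
      intro j
      have hP : IsCompact (⋃ i ∈ {i | (i, j) ∈ E}, R i j '' G i j) :=
        (toFinite _).isCompact_biUnion fun i hi => (hG i j hi).image_of_continuousOn (hR i j hi)
      have hd : Disjoint (⋃ i ∈ {i | (i, j) ∈ E}, R i j '' G i j)
          (jumpSet E G R (n + 1) j) := by
        rw [Set.disjoint_left]
        intro y hy hy'
        obtain ⟨i, hi, x, hx, rfl⟩ := mem_iUnion₂.1 hy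
        exact absurd (show x ∈ jumpSet E G R (n + 1 + 1) i from ⟨j, hi, hx, hy'⟩)
          (by rw [h i]; exact notMem_empty _)
      obtain ⟨φ, h0, h1, h01⟩ := exists_contMDiffMap_zero_one_nhds_of_isClosed
        (n := 1) (modelWithCornersSelf ℝ (X j)) hP.isClosed
        (isCompact_jumpSet_succ hG hR n j).isClosed hd
      refine ⟨φ, φ.contMDiff.contDiff, fun i hi x hx => ?_, fun x => (h01 x).1, ?_⟩
      · exact h0.self_of_nhdsSet _ (mem_biUnion hi (mem_image_of_mem _ hx))
      · obtain ⟨U, hU, hSU, hU1⟩ := mem_nhdsSet_iff_exists.1 h1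
        exact ⟨U, hU, hSU, hU1⟩
    choose φ hφC hφ0 hφn U hUo hSU hφ1 using hφ
    -- Deleting the open sets `U j` keeps the guards compact and removes every start of a maximal
    -- chain, so the induction hypothesis applies.
    let G' : ∀ j : J, J → Set (X j) := fun j k => G j k \ U j
    have hG'G : ∀ j k, G' j k ⊆ G j k := fun j k => sdiff_subset
    obtain ⟨g, hgC, hg⟩ := ih G' (fun j k hjk => (hG j k hjk).diff (hUo j))
      (fun j k hjk => (hR j k hjk).mono (hG'G j k)) (fun j => by
        rw [eq_empty_iff_forall_notMem]
        intro x hx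
        have hxU := hSU j (jumpSet_mono hG'G _ j hx)
        obtain ⟨k, -, hxG, -⟩ := hx
        exact hxG.2 hxU)
    have hbound : ∀ e : J × J, ∃ c : ℝ, e ∈ E → ∀ x ∈ G e.1 e.2,
        g e.2 (R e.1 e.2 x) - g e.1 x ≤ c := by
      intro e
      by_cases he : e ∈ E
      · obtain ⟨c, hc⟩ := (hG e.1 e.2 he).bddAbove_image
          (f := fun x => g e.2 (R e.1 e.2 x) - g e.1 x)
          (((hgC e.2).continuous.comp_continuousOn (hR e.1 e.2 he)).sub
            (hgC e.1).continuous.continuousOn)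
        exact ⟨c, fun _ x hx => hc (mem_image_of_mem _ hx)⟩
      · exact ⟨0, fun h => absurd h he⟩
    choose c hc using hbound
    obtain ⟨M, hM⟩ := (E.image c).exists_le
    -- On `U j` the bump term drops by `|M| + 1`, which outweighs the increase of `g`, at most `M`.
    -- Off `U j`, `g` already decreases and the bump term cannot increase.
    refine ⟨fun j x => g j x + (|M| + 1) * φ j x,
      fun j => (hgC j).add (contDiff_const.mul (hφC j)), fun j k hjk x hx => ?_⟩
    have hM0 : 0 ≤ |M| := abs_nonneg M
    simp only [hφ0 k j hjk x hx, mul_zero, add_zero]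
    by_cases hxU : x ∈ U j
    · rw [hφ1 j x hxU]
      have h1 := hc (j, k) hjk x hx
      have h2 := hM _ (Finset.mem_image_of_mem c hjk)
      have h3 := le_abs_self M
      simp only at h1
      linarith
    · have h1 := hg j k hjk x ⟨hx, hxU⟩
      have h2 := mul_nonneg (by linarith : 0 ≤ |M| + 1) (hφn j x)
      linarith

/-! ### Measures carried by a set -/

section MPlus

variable {α β : Type*} [MeasurableSpace α] [MeasurableSpace β]

theorem restrict_eq_self_of_mem_MPlus {K : Set α} {μ : Measure α} (h : μ ∈ MPlus K) :
    μ.restrict K = μ :=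
  Measure.restrict_eq_self_of_ae_mem (measure_eq_zero_iff_ae_notMem.1 h.2 |>.mono fun _ hx =>
    not_not.1 hx)

theorem ae_mem_of_mem_MPlus {K : Set α} {μ : Measure α} (h : μ ∈ MPlus K) : ∀ᵐ x ∂μ, x ∈ K :=
  (measure_eq_zero_iff_ae_notMem.1 h.2).mono fun _ hx => not_not.1 hx

theorem prod_mem_MPlus {K : Set α} {L : Set β} {μ : Measure α} {ν : Measure β}
    (hμ : μ ∈ MPlus K) (hν : ν ∈ MPlus L) : μ.prod ν ∈ MPlus (K ×ˢ L) := by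
  have := hμ.1
  have := hν.1
  refine ⟨inferInstance, ?_⟩
  rw [compl_prod_eq_union]
  refine measure_union_null ?_ ?_
  · rw [Measure.prod_prod, hμ.2, zero_mul]
  · rw [Measure.prod_prod, hν.2, mul_zero]

theorem map_mem_MPlus {K : Set α} {L : Set β} (hL : MeasurableSet L) {μ : Measure α}
    (hμ : μ ∈ MPlus K) {f : α → β} (hf : AEMeasurable f μ) (hKL : MapsTo f K L) :
    μ.map f ∈ MPlus L := by
  have := hμ.1
  refine ⟨inferInstance, ?_⟩
  rw [Measure.map_apply_of_aemeasurable hf hL.compl]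
  exact measure_mono_null (fun x hx hxK => hx (hKL hxK)) hμ.2

theorem dirac_mem_MPlus {K : Set α} (hK : MeasurableSet K) {a : α} (ha : a ∈ K) :
    Measure.dirac a ∈ MPlus K :=
  ⟨inferInstance, by rw [Measure.dirac_apply' _ hK.compl]; simp [ha]⟩

variable [TopologicalSpace α] [T2Space α] [OpensMeasurableSpace α]

theorem integrable_of_mem_MPlus {K : Set α} (hK : IsCompact K) {μ : Measure α} (hμ : μ ∈ MPlus K)
    {F : α → ℝ} (hF : ContinuousOn F K) : Integrable F μ := by
  have := hμ.1
  have h := hF.integrableOn_compact' (μ := μ) hK hK.measurableSet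
  rwa [IntegrableOn, restrict_eq_self_of_mem_MPlus hμ] at h

end MPlus

/-! ### Compactness of the data and consequences of the no-Zeno assumption -/

namespace QuasiUncertainHybridSystem

variable {J : Type*} [Fintype J] [DecidableEq J] (H : QuasiUncertainHybridSystem J)

theorem isCompact_G {j k : J} (h : (j, k) ∈ H.E) : IsCompact (H.G j k) :=
  (H.isCompact_D j).of_isClosed_subset (H.isClosed_G j k h)
    ((H.G_subset j k h).trans (H.isCompact_D j).isClosed.frontier_subset)

theorem G_subset_D {j k : J} (h : (j, k) ∈ H.E) : H.G j k ⊆ H.D j :=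
  (H.G_subset j k h).trans (H.isCompact_D j).isClosed.frontier_subset

theorem isCompact_Ω (T : ℝ) (j : J) : IsCompact (H.Ω T j) :=
  isCompact_Icc.prod ((H.isCompact_D j).prod (H.isCompact_Θ j))

theorem isCompact_guard (T : ℝ) {j k : J} (h : (j, k) ∈ H.E) :
    IsCompact (Icc 0 T ×ˢ H.G j k ×ˢ H.Θ j) :=
  isCompact_Icc.prod ((H.isCompact_G h).prod (H.isCompact_Θ j))

/-- Under the no-Zeno assumption there are `C¹` functions that strictly decrease at every reset:
otherwise compactness gives an execution with infinitely many transitions at time `0`. -/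
theorem exists_contDiff_reset_lt (hZeno : H.NoZeno) :
    ∃ g : ∀ j, H.X j → ℝ, (∀ j, ContDiff ℝ 1 (g j)) ∧
      ∀ j k, (j, k) ∈ H.E → ∀ x ∈ H.G j k, g k (H.R j k x) < g j x := by
  have hG : ∀ j k, (j, k) ∈ H.E → IsCompact (H.G j k) := fun j k h => H.isCompact_G h
  have hR : ∀ j k, (j, k) ∈ H.E → ContinuousOn (H.R j k) (H.G j k) := fun j k h =>
    (H.contDiffOn_R j k h).continuousOn
  by_cases h : ∀ n, ∃ j, (jumpSet H.E H.G H.R n j).Nonempty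
  · exfalso
    obtain ⟨s, hs⟩ := exists_infinite_jumps (X := H.X) hG hR h
    have hθ : ∀ n, ((H.μΘ (s n).1).support).Nonempty := fun n =>
      have := H.isProbabilityMeasure_μΘ (s n).1
      Measure.nonempty_support (IsProbabilityMeasure.ne_zero _)
    -- All transition times are 0 and the arcs are constant: the differential equation holds almost
    -- everywhere on the null set `[0, 0]`, and the intervals on which guards must be avoided are
    -- empty.
    refine hZeno ⟨⟨fun n => (s n).1, fun _ => 0, fun n => (hθ n).some, fun n _ => (s n).2, rfl,
      fun _ => le_rfl, fun n => (hθ n).some_mem, fun n => ⟨?_, ?_, ?_⟩, ?_, fun n => (hs n).1,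
      fun n => (hs n).2.1, fun n => (hs n).2.2⟩, 0, fun _ => le_rfl⟩
    · exact (LipschitzWith.const _).lipschitzOnWith.absolutelyContinuousOnInterval
    · exact fun _ _ => H.G_subset_D (hs n).1 (hs n).2.1
    · simp
    · intro n t ht
      simp at ht
  · push Not at h
    obtain ⟨n, hn⟩ := h
    exact exists_contDiff_lt_of_jumpSet_eq_empty (X := H.X) n H.G hG hR fun j =>
      subset_eq_empty (jumpSet_succ_subset n j) (hn j)

/-! ### The Liouville operator and averages over the parameter -/

/-- The two partial derivatives combine by the chain rule into one directional derivative, from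
which continuity and linearity in `v` are immediate. -/
theorem liouvilleOp_eq_fderiv {j : J} {v : ℝ × H.X j × H.Y j → ℝ} (hv : ContDiff ℝ 1 v)
    (z : ℝ × H.X j × H.Y j) :
    H.liouvilleOp j v z = fderiv ℝ v z (1, H.f j z.2, 0) := by
  obtain ⟨t, x, θ⟩ := z
  have hd : HasFDerivAt v (fderiv ℝ v (t, x, θ)) (t, x, θ) :=
    (hv.differentiable one_ne_zero _).hasFDerivAt
  have h1 : HasDerivAt (fun s => v (s, x, θ)) (fderiv ℝ v (t, x, θ) (1, 0, 0)) t :=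
    hd.comp_hasDerivAt t ((hasDerivAt_id t).prodMk ((hasDerivAt_const t x).prodMk
      (hasDerivAt_const t θ)))
  have h2 : HasFDerivAt (fun y => v (t, y, θ)) ((fderiv ℝ v (t, x, θ)).comp
      ((0 : H.X j →L[ℝ] ℝ).prod ((ContinuousLinearMap.id ℝ (H.X j)).prod 0))) x :=
    HasFDerivAt.comp x hd ((hasFDerivAt_const t x).prodMk ((hasFDerivAt_id x).prodMk
      (hasFDerivAt_const θ x)))
  simp only [liouvilleOp]
  rw [h1.deriv, h2.fderiv]
  simp only [ContinuousLinearMap.comp_apply, ContinuousLinearMap.prod_apply]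
  rw [← map_add]
  simp

theorem continuousOn_f (j : J) : ContinuousOn (H.f j) (H.D j ×ˢ H.Θ j) :=
  (H.lipschitz_f j).choose_spec.continuousOn

theorem continuousOn_liouvilleOp (T : ℝ) {j : J} {v : ℝ × H.X j × H.Y j → ℝ}
    (hv : ContDiff ℝ 1 v) : ContinuousOn (H.liouvilleOp j v) (H.Ω T j) := by
  rw [funext (H.liouvilleOp_eq_fderiv hv)]
  refine (hv.continuous_fderiv one_ne_zero).continuousOn.clm_apply
    (continuousOn_const.prodMk (ContinuousOn.prodMk ?_ continuousOn_const))
  exact (H.continuousOn_f j).comp continuousOn_snd fun z hz => hz.2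

theorem liouvilleOp_add {j : J} {v w : ℝ × H.X j × H.Y j → ℝ} (hv : ContDiff ℝ 1 v)
    (hw : ContDiff ℝ 1 w) (z : ℝ × H.X j × H.Y j) :
    H.liouvilleOp j (v + w) z = H.liouvilleOp j v z + H.liouvilleOp j w z := by
  have h : ContDiff ℝ 1 (v + w) := hv.add hw
  rw [H.liouvilleOp_eq_fderiv hv, H.liouvilleOp_eq_fderiv hw, H.liouvilleOp_eq_fderiv h,
    fderiv_add (hv.differentiable one_ne_zero _) (hw.differentiable one_ne_zero _)]
  rfl

theorem liouvilleOp_smul {j : J} {v : ℝ × H.X j × H.Y j → ℝ} (hv : ContDiff ℝ 1 v) (c : ℝ)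
    (z : ℝ × H.X j × H.Y j) : H.liouvilleOp j (c • v) z = c * H.liouvilleOp j v z := by
  have h : ContDiff ℝ 1 (c • v) := hv.const_smul c
  rw [H.liouvilleOp_eq_fderiv hv, H.liouvilleOp_eq_fderiv h,
    fderiv_const_smul (hv.differentiable one_ne_zero _)]
  rfl

/-- The average of `v` over the uncertain parameter. -/
def avg (j : J) (v : ℝ × H.X j × H.Y j → ℝ) (y : ℝ × H.X j) : ℝ :=
  ∫ θ, v (y.1, y.2, θ) ∂(H.μΘ j)

variable {H}

theorem integrable_μΘ {j : J} {u : H.Y j → ℝ} (hu : Continuous u) : Integrable u (H.μΘ j) :=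
  integrable_of_mem_MPlus (H.isCompact_Θ j) (H.μΘ_mem j) hu.continuousOn

theorem continuous_avg {j : J} {v : ℝ × H.X j × H.Y j → ℝ} (hv : Continuous v) :
    Continuous (H.avg j v) := by
  have := H.isProbabilityMeasure_μΘ j
  have h := continuous_parametric_integral_of_continuous (μ := H.μΘ j)
    (f := fun (y : ℝ × H.X j) (θ : H.Y j) => v (y.1, y.2, θ))
    (by unfold Function.uncurry; fun_prop) (H.isCompact_Θ j)
  rw [restrict_eq_self_of_mem_MPlus (H.μΘ_mem j)] at h
  exact h

theorem avg_add {j : J} {v w : ℝ × H.X j × H.Y j → ℝ} (hv : Continuous v) (hw : Continuous w)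
    (y : ℝ × H.X j) : H.avg j (v + w) y = H.avg j v y + H.avg j w y :=
  integral_add (integrable_μΘ (by fun_prop)) (integrable_μΘ (by fun_prop))

theorem avg_smul {j : J} (v : ℝ × H.X j × H.Y j → ℝ) (c : ℝ)
    (y : ℝ × H.X j) : H.avg j (c • v) y = c * H.avg j v y :=
  integral_const_mul _ _

theorem continuousOn_avg_reset {T : ℝ} {j k : J} (h : (j, k) ∈ H.E)
    {v : ℝ × H.X k × H.Y k → ℝ} (hv : Continuous v) :
    ContinuousOn (fun z : ℝ × H.X j × H.Y j => H.avg k v (z.1, H.R j k z.2.1))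
      (Icc 0 T ×ˢ H.G j k ×ˢ H.Θ j) := by
  refine (continuous_avg hv).comp_continuousOn (continuousOn_fst.prodMk ?_)
  exact (H.contDiffOn_R j k h).continuousOn.comp (by fun_prop) fun z hz => hz.2.1

/-! ### Integrals against the starting and final measures -/

theorem integral_dirac_prod {α β : Type*} [MeasurableSpace α] [MeasurableSpace β]
    [MeasurableSingletonClass α] (a : α) (ν : Measure β) [SFinite ν] (F : α × β → ℝ)
    (hF : Integrable F ((Measure.dirac a).prod ν)) :
    ∫ z, F z ∂((Measure.dirac a).prod ν) = ∫ y, F (a, y) ∂ν := by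
  rw [integral_prod _ hF, integral_dirac]

theorem integral_initial {p : H.PrimalVar} {j : J} (h0 : p.μ0 j ∈ MPlus (H.D j))
    {v : ℝ × H.X j × H.Y j → ℝ} (hv : Continuous v) :
    Integrable v ((Measure.dirac (0 : ℝ)).prod ((p.μ0 j).prod (H.μΘ j))) ∧
    ∫ z, v z ∂((Measure.dirac (0 : ℝ)).prod ((p.μ0 j).prod (H.μΘ j))) =
      ∫ x, H.avg j v (0, x) ∂(p.μ0 j) := by
  have := h0.1
  have := H.isProbabilityMeasure_μΘ j
  have hp := prod_mem_MPlus h0 (H.μΘ_mem j)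
  have hi : Integrable v ((Measure.dirac (0 : ℝ)).prod ((p.μ0 j).prod (H.μΘ j))) :=
    integrable_of_mem_MPlus (isCompact_singleton.prod ((H.isCompact_D j).prod (H.isCompact_Θ j)))
      (prod_mem_MPlus (dirac_mem_MPlus (measurableSet_singleton _) (mem_singleton _)) hp)
      hv.continuousOn
  refine ⟨hi, ?_⟩
  rw [integral_dirac_prod _ _ _ hi, integral_prod]
  · rfl
  · exact integrable_of_mem_MPlus ((H.isCompact_D j).prod (H.isCompact_Θ j)) hp
      (by fun_prop)

/-- The reset map is controlled only on its guard. Since the guard measure is carried there,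
continuity on the guard gives the almost-everywhere measurability that the push-forward needs;
Fubini then produces the average. -/
theorem integral_reset {T : ℝ} {p : H.PrimalVar} {i j : J} (hij : (i, j) ∈ H.E)
    (hG : p.μG i j ∈ MPlus (Icc 0 T ×ˢ H.G i j ×ˢ H.Θ i))
    {v : ℝ × H.X j × H.Y j → ℝ} (hv : Continuous v) :
    Integrable v (((((p.μG i j).map (fun z => (z.1, z.2.1))).map
        (fun y : ℝ × H.X i => (y.1, H.R i j y.2))).prod (H.μΘ j)).map MeasurableEquiv.prodAssoc) ∧
    ∫ z, v z ∂(((((p.μG i j).map (fun z => (z.1, z.2.1))).map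
        (fun y : ℝ × H.X i => (y.1, H.R i j y.2))).prod (H.μΘ j)).map MeasurableEquiv.prodAssoc) =
      ∫ z, H.avg j v (z.1, H.R i j z.2.1) ∂(p.μG i j) := by
  have := hG.1
  have := H.isProbabilityMeasure_μΘ j
  have hm1 : Measurable (fun z : ℝ × H.X i × H.Y i => (z.1, z.2.1)) := by fun_prop
  have hGc := (isCompact_Icc (a := (0 : ℝ)) (b := T)).prod (H.isCompact_G hij)
  have h1 : (p.μG i j).map (fun z => (z.1, z.2.1)) ∈ MPlus (Icc 0 T ×ˢ H.G i j) :=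
    map_mem_MPlus hGc.measurableSet hG hm1.aemeasurable fun z hz => ⟨hz.1, hz.2.1⟩
  have hm2 : AEMeasurable (fun y : ℝ × H.X i => (y.1, H.R i j y.2))
      ((p.μG i j).map (fun z => (z.1, z.2.1))) := by
    rw [← restrict_eq_self_of_mem_MPlus h1]
    refine ContinuousOn.aemeasurable (continuousOn_fst.prodMk ?_) hGc.measurableSet
    exact (H.contDiffOn_R i j hij).continuousOn.comp (by fun_prop) fun z hz => hz.2
  have hDc := (isCompact_Icc (a := (0 : ℝ)) (b := T)).prod (H.isCompact_D j)
  have h2 := map_mem_MPlus hDc.measurableSet h1 hm2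
    fun z hz => ⟨hz.1, H.mapsTo_R i j hij hz.2⟩
  have h3 := prod_mem_MPlus h2 (H.μΘ_mem j)
  have hi : Integrable (fun z => v (MeasurableEquiv.prodAssoc z))
      ((((p.μG i j).map (fun z => (z.1, z.2.1))).map
        (fun y : ℝ × H.X i => (y.1, H.R i j y.2))).prod (H.μΘ j)) := by
    refine integrable_of_mem_MPlus (hDc.prod (H.isCompact_Θ j)) h3 ?_
    exact (hv.comp (Homeomorph.prodAssoc _ _ _).continuous).continuousOn
  refine ⟨(integrable_map_equiv _ _).2 hi, ?_⟩
  have := h2.1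
  rw [integral_map_equiv, integral_prod _ hi]
  have hc : Continuous (H.avg j v) := continuous_avg hv
  change ∫ y, H.avg j v y ∂_ = _
  rw [integral_map hm2 hc.aestronglyMeasurable, integral_map hm1.aemeasurable]
  exact (hc.measurable.comp_aemeasurable hm2).aestronglyMeasurable

/-- The measures of `p` are supported where the primal program requires. -/
structure PrimalVar.Supported (T : ℝ) (XT : ∀ j, Set (H.X j)) (p : H.PrimalVar) : Prop where
  mem_μ : ∀ j, p.μ j ∈ MPlus (H.Ω T j)
  mem_μ0 : ∀ j, p.μ0 j ∈ MPlus (H.D j)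
  mem_μT : ∀ j, p.μT j ∈ MPlus (XT j ×ˢ H.Θ j)
  mem_μ0hat : ∀ j, p.μ0hat j ∈ MPlus (H.D j)
  mem_μG : ∀ j k, (j, k) ∈ H.E → p.μG j k ∈ MPlus (Icc 0 T ×ˢ H.G j k ×ˢ H.Θ j)

variable {T : ℝ} {XT : ∀ j, Set (H.X j)} {p : H.PrimalVar}

theorem integral_startMeasure (hp : p.Supported T XT) (j : J) {v : ℝ × H.X j × H.Y j → ℝ}
    (hv : Continuous v) :
    ∫ z, v z ∂(H.startMeasure p j) = ∫ x, H.avg j v (0, x) ∂(p.μ0 j) +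
      ∑ i with (i, j) ∈ H.E, ∫ z, H.avg j v (z.1, H.R i j z.2.1) ∂(p.μG i j) := by
  have h0 := integral_initial (hp.mem_μ0 j) hv
  have hG := fun i (hi : i ∈ Finset.univ.filter (fun i => (i, j) ∈ H.E)) =>
    integral_reset (Finset.mem_filter.1 hi).2 (hp.mem_μG i j (Finset.mem_filter.1 hi).2) hv
  rw [startMeasure, integral_add_measure h0.1 (integrable_finsetSum_measure.2 fun i hi =>
    (hG i hi).1), h0.2, integral_finsetSum_measure fun i hi => (hG i hi).1]
  congr 1
  exact Finset.sum_congr rfl fun i hi => (hG i hi).2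

theorem integral_finalMeasure (hXT : ∀ j, IsCompact (XT j)) (hp : p.Supported T XT) (j : J)
    {v : ℝ × H.X j × H.Y j → ℝ} (hv : Continuous v) :
    ∫ z, v z ∂(H.finalMeasure T p j) = ∫ z, v (T, z) ∂(p.μT j) +
      ∑ k with (j, k) ∈ H.E, ∫ z, v z ∂(p.μG j k) := by
  have := (hp.mem_μT j).1
  have hT : Integrable v ((Measure.dirac T).prod (p.μT j)) :=
    integrable_of_mem_MPlus (isCompact_singleton.prod ((hXT j).prod (H.isCompact_Θ j)))
      (prod_mem_MPlus (dirac_mem_MPlus (measurableSet_singleton _) (mem_singleton _))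
        (hp.mem_μT j)) hv.continuousOn
  have hG : ∀ k ∈ Finset.univ.filter (fun k => (j, k) ∈ H.E), Integrable v (p.μG j k) :=
    fun k hk => integrable_of_mem_MPlus (H.isCompact_guard T (Finset.mem_filter.1 hk).2)
      (hp.mem_μG j k (Finset.mem_filter.1 hk).2) hv.continuousOn
  rw [finalMeasure, integral_add_measure hT (integrable_finsetSum_measure.2 hG),
    integral_dirac_prod _ _ _ hT, integral_finsetSum_measure hG]

end QuasiUncertainHybridSystem

/-! ### Finite products of spaces of continuous functions -/

/-- Restriction to `S` of a linear family of functions that are continuous on `S`. -/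
def restrictContinuous {V α : Type*} [AddCommGroup V] [Module ℝ V] [TopologicalSpace α] (S : Set α)
    (L : V →ₗ[ℝ] (α → ℝ)) (h : ∀ d, ContinuousOn (L d) S) : V →ₗ[ℝ] C(S, ℝ) where
  toFun d := ⟨S.domRestrict (L d), (h d).domRestrict⟩
  map_add' d e := by simp_rw [map_add]; rfl
  map_smul' c d := by simp_rw [map_smul]; rfl

theorem exists_mem_MPlus_sum_integral_eq {ι : Type*} [Fintype ι] {α : ι → Type*}
    [∀ i, TopologicalSpace (α i)] [∀ i, T2Space (α i)] [∀ i, MeasurableSpace (α i)]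
    [∀ i, BorelSpace (α i)] {S : ∀ i, Set (α i)} (hS : ∀ i, IsCompact (S i))
    (Λ : (∀ i, C(S i, ℝ)) →ₗ[ℝ] ℝ) (hΛ : ∀ y, 0 ≤ y → 0 ≤ Λ y) :
    ∃ μ : ∀ i, Measure (α i), (∀ i, μ i ∈ MPlus (S i)) ∧
      ∀ (y : ∀ i, C(S i, ℝ)) (F : ∀ i, α i → ℝ), (∀ i, ∀ x : S i, F i x = y i x) →
        Λ y = ∑ i, ∫ x, F i x ∂(μ i) := by
  classical
  have h := fun i => exists_mem_MPlus_integral_eq (hS i)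
    (Λ.comp (LinearMap.single ℝ (fun i => C(S i, ℝ)) i)) fun g hg => by
      refine hΛ _ ?_
      rw [LinearMap.coe_single]
      exact Pi.single_nonneg.2 hg
  choose μ hμ hint using h
  refine ⟨μ, hμ, fun y F hF => ?_⟩
  conv_lhs => rw [← Finset.univ_sum_single y, map_sum]
  exact Finset.sum_congr rfl fun i _ => (hint i (y i) (F i) (hF i)).symm

/-- By compactness the quotient `-y / g` is bounded above. The statement is eventual in `c` so that
several blocks of constraints can share one constant. -/
theorem eventually_nonneg_add_smul {ι : Type*} [Finite ι] {K : ι → Type*}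
    [∀ i, TopologicalSpace (K i)] [∀ i, CompactSpace (K i)] {g : ∀ i, C(K i, ℝ)}
    (hg : ∀ i x, 0 < g i x) (y : ∀ i, C(K i, ℝ)) :
    ∀ᶠ c : ℝ in Filter.atTop, 0 ≤ y + c • g := by
  have : ∀ i, ∀ᶠ c : ℝ in Filter.atTop, 0 ≤ y i + c • g i := by
    intro i
    obtain ⟨B, hB⟩ := isCompact_univ.bddAbove_image
      (f := fun x => -(y i x) / g i x)
      (((y i).continuous.neg.div (g i).continuous fun x => (hg i x).ne').continuousOn)
    filter_upwards [Filter.eventually_ge_atTop B] with c hc x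
    have h1 : -(y i x) / g i x ≤ c := (hB (mem_image_of_mem _ (mem_univ x))).trans hc
    rw [div_le_iff₀ (hg i x)] at h1
    change 0 ≤ y i x + c * g i x
    linarith
  filter_upwards [Filter.eventually_all.2 this] with c hc i using hc i

/-! ### The pairing and weak duality -/

namespace QuasiUncertainHybridSystem

variable {J : Type*} [Fintype J] [DecidableEq J] {H : QuasiUncertainHybridSystem J}
  {T : ℝ} {XT : ∀ j, Set (H.X j)} {p : H.PrimalVar}

theorem sum_edges (F : J → J → ℝ) :
    ∑ e ∈ H.E, F e.1 e.2 = ∑ j, ∑ k with (j, k) ∈ H.E, F j k := by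
  simp_rw [Finset.sum_filter]
  rw [← Fintype.sum_prod_type' (f := fun j k => if (j, k) ∈ H.E then F j k else 0)]
  simp

theorem sum_edges' (F : J → J → ℝ) :
    ∑ e ∈ H.E, F e.1 e.2 = ∑ k, ∑ j with (j, k) ∈ H.E, F j k := by
  simp_rw [Finset.sum_filter]
  rw [← Fintype.sum_prod_type_right' (f := fun j k => if (j, k) ∈ H.E then F j k else 0)]
  simp

/-- The pairing of the dual constraint functions with the primal measures. -/
def pairing (H : QuasiUncertainHybridSystem J) (T : ℝ) (p : H.PrimalVar) (d : H.DualVar) : ℝ :=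
  ∑ j, ∫ z, (d.v j (T, z) + d.q) ∂(p.μT j) + ∑ j, ∫ z, -H.liouvilleOp j (d.v j) z ∂(p.μ j) +
    ∑ j, ∫ x, d.w j x ∂(p.μ0hat j) +
    ∑ j, ∫ x, (d.w j x - H.avg j (d.v j) (0, x) - d.q) ∂(p.μ0 j) +
    ∑ e ∈ H.E, ∫ z, (d.v e.1 z - H.avg e.2 (d.v e.2) (z.1, H.R e.1 e.2 z.2.1)) ∂(p.μG e.1 e.2)

/-- The adjoint computation: the pairing, defined constraint by constraint in the dual, is regrouped
by dual variable, and the coefficients of `v`, `w` and `q` are the residuals of the primal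
constraints. Edge sums are indexed by source for the final measure and by target for the starting
measure. -/
theorem pairing_eq (hXT : ∀ j, IsCompact (XT j)) (hp : p.Supported T XT) {d : H.DualVar}
    (hv : ∀ j, ContDiff ℝ 1 (d.v j)) (hw : ∀ j, ContinuousOn (d.w j) (H.D j)) :
    H.pairing T p d =
      ∑ j, (∫ z, d.v j z ∂(H.finalMeasure T p j) - ∫ z, H.liouvilleOp j (d.v j) z ∂(p.μ j) -
        ∫ z, d.v j z ∂(H.startMeasure p j)) +
      ∑ j, (∫ x, d.w j x ∂(p.μ0 j) + ∫ x, d.w j x ∂(p.μ0hat j)) +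
      d.q * (∑ j, ∫ _z, (1 : ℝ) ∂(p.μT j) - ∑ j, ∫ _x, (1 : ℝ) ∂(p.μ0 j)) := by
  have hvc := fun j => (hv j).continuous
  have h1 : ∀ j, ∫ z, (d.v j (T, z) + d.q) ∂(p.μT j) =
      ∫ z, d.v j (T, z) ∂(p.μT j) + d.q * ∫ _z, (1 : ℝ) ∂(p.μT j) := fun j => by
    have hc := (hXT j).prod (H.isCompact_Θ j)
    have := hvc j
    rw [integral_add (integrable_of_mem_MPlus hc (hp.mem_μT j) (by fun_prop))
      (integrable_of_mem_MPlus hc (hp.mem_μT j) (by fun_prop)), ← integral_const_mul]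
    simp only [mul_one]
  have h4 : ∀ j, ∫ x, (d.w j x - H.avg j (d.v j) (0, x) - d.q) ∂(p.μ0 j) =
      ∫ x, d.w j x ∂(p.μ0 j) - ∫ x, H.avg j (d.v j) (0, x) ∂(p.μ0 j) -
        d.q * ∫ _x, (1 : ℝ) ∂(p.μ0 j) := fun j => by
    have hc := H.isCompact_D j
    have ha := continuous_avg (hvc j)
    have i1 := integrable_of_mem_MPlus hc (hp.mem_μ0 j) (hw j)
    have i2 : Integrable (fun x => H.avg j (d.v j) (0, x)) (p.μ0 j) :=
      integrable_of_mem_MPlus hc (hp.mem_μ0 j) (by fun_prop)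
    have i3 : Integrable (fun x => d.w j x - H.avg j (d.v j) (0, x)) (p.μ0 j) := i1.sub i2
    rw [integral_sub i3 (integrable_of_mem_MPlus hc (hp.mem_μ0 j) (by fun_prop)),
      integral_sub i1 i2, ← integral_const_mul]
    simp only [mul_one]
  have h5 : ∀ e ∈ H.E,
      ∫ z, (d.v e.1 z - H.avg e.2 (d.v e.2) (z.1, H.R e.1 e.2 z.2.1)) ∂(p.μG e.1 e.2) =
      ∫ z, d.v e.1 z ∂(p.μG e.1 e.2) -
        ∫ z, H.avg e.2 (d.v e.2) (z.1, H.R e.1 e.2 z.2.1) ∂(p.μG e.1 e.2) := fun e he =>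
    integral_sub (integrable_of_mem_MPlus (H.isCompact_guard T he) (hp.mem_μG _ _ he)
      (hvc e.1).continuousOn) (integrable_of_mem_MPlus (H.isCompact_guard T he)
        (hp.mem_μG _ _ he) (continuousOn_avg_reset he (hvc e.2)))
  rw [pairing, Finset.sum_congr rfl h5, Finset.sum_sub_distrib,
    sum_edges fun j k => ∫ z, d.v j z ∂(p.μG j k),
    sum_edges' fun j k => ∫ z, H.avg k (d.v k) (z.1, H.R j k z.2.1) ∂(p.μG j k)]
  simp only [h1, h4, integral_startMeasure hp _ (hvc _), integral_finalMeasure hXT hp _ (hvc _),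
    Finset.sum_add_distrib, Finset.sum_sub_distrib, integral_neg, Finset.sum_neg_distrib,
    ← Finset.mul_sum]
  ring

theorem PrimalFeasible.supported (h : H.PrimalFeasible T XT p) : p.Supported T XT :=
  ⟨h.mem_μ, h.mem_μ0, h.mem_μT, h.mem_μ0hat, h.mem_μG⟩

theorem PrimalFeasible.pairing_eq (hXT : ∀ j, IsCompact (XT j)) (h : H.PrimalFeasible T XT p)
    {d : H.DualVar} (hv : ∀ j, ContDiff ℝ 1 (d.v j))
    (hw : ∀ j, ContinuousOn (d.w j) (H.D j)) :
    H.pairing T p d = ∑ j, ∫ x in H.D j, d.w j x := by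
  rw [QuasiUncertainHybridSystem.pairing_eq hXT h.supported hv hw, h.mass, sub_self, mul_zero,
    add_zero, Finset.sum_eq_zero, zero_add]
  · refine Finset.sum_congr rfl fun j _ => ?_
    rw [← h.slack j, integral_add_measure
      (integrable_of_mem_MPlus (H.isCompact_D j) (h.mem_μ0 j) (hw j))
      (integrable_of_mem_MPlus (H.isCompact_D j) (h.mem_μ0hat j) (hw j))]
  · intro j _
    have := h.liouville j _ (hv j)
    linarith

theorem weak_duality (hXT : ∀ j, IsCompact (XT j)) (h : H.PrimalFeasible T XT p)
    {d : H.DualVar} (hd : H.DualFeasible T XT d) :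
    ∑ j, ∫ _x, (1 : ℝ) ∂(p.μ0 j) ≤ ∑ j, ∫ x in H.D j, d.w j x := by
  rw [← h.pairing_eq hXT hd.contDiff_v hd.continuousOn_w, pairing]
  have h1 : 0 ≤ ∑ j, ∫ z, (d.v j (T, z) + d.q) ∂(p.μT j) :=
    Finset.sum_nonneg fun j _ => integral_nonneg_of_ae <|
      (ae_mem_of_mem_MPlus (h.mem_μT j)).mono fun z hz => hd.terminal j _ hz.1 _ hz.2
  have h2 : 0 ≤ ∑ j, ∫ z, -H.liouvilleOp j (d.v j) z ∂(p.μ j) :=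
    Finset.sum_nonneg fun j _ => integral_nonneg_of_ae <|
      (ae_mem_of_mem_MPlus (h.mem_μ j)).mono fun z hz => hd.flow j _ hz
  have h3 : 0 ≤ ∑ j, ∫ x, d.w j x ∂(p.μ0hat j) :=
    Finset.sum_nonneg fun j _ => integral_nonneg_of_ae <|
      (ae_mem_of_mem_MPlus (h.mem_μ0hat j)).mono fun z hz => hd.w_nonneg j _ hz
  have h4 : ∑ j, ∫ _x, (1 : ℝ) ∂(p.μ0 j) ≤
      ∑ j, ∫ x, (d.w j x - H.avg j (d.v j) (0, x) - d.q) ∂(p.μ0 j) := by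
    refine Finset.sum_le_sum fun j _ => integral_mono_ae ?_ ?_ ?_
    · exact integrable_of_mem_MPlus (H.isCompact_D j) (h.mem_μ0 j) continuousOn_const
    · have ha := continuous_avg (hd.contDiff_v j).continuous
      refine integrable_of_mem_MPlus (H.isCompact_D j) (h.mem_μ0 j) ?_
      exact ((hd.continuousOn_w j).sub (by fun_prop)).sub continuousOn_const
    · exact (ae_mem_of_mem_MPlus (h.mem_μ0 j)).mono fun z hz => hd.initial j _ hz
  have h5 : 0 ≤ ∑ e ∈ H.E, ∫ z, (d.v e.1 z - H.avg e.2 (d.v e.2) (z.1, H.R e.1 e.2 z.2.1))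
      ∂(p.μG e.1 e.2) :=
    Finset.sum_nonneg fun e he => integral_nonneg_of_ae <|
      (ae_mem_of_mem_MPlus (h.mem_μG e.1 e.2 he)).mono fun z hz =>
        hd.guard e.1 e.2 he _ hz.1 _ hz.2.1 _ hz.2.2
  linarith

/-! ### The Slater point -/

/-- The dual constraints can be satisfied strictly. -/
theorem exists_strictly_feasible (hZeno : H.NoZeno) (hXT : ∀ j, IsCompact (XT j)) :
    ∃ d : H.DualVar, (∀ j, ContDiff ℝ 1 (d.v j)) ∧ (∀ j, Continuous (d.w j)) ∧
      (∀ j, ∀ z ∈ XT j ×ˢ H.Θ j, 0 < d.v j (T, z) + d.q) ∧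
      (∀ j, ∀ z ∈ H.Ω T j, 0 < -H.liouvilleOp j (d.v j) z) ∧
      (∀ j, ∀ x, 0 < d.w j x) ∧
      (∀ j, ∀ x, 0 < d.w j x - H.avg j (d.v j) (0, x) - d.q) ∧
      ∀ e ∈ H.E, ∀ z ∈ Icc 0 T ×ˢ H.G e.1 e.2 ×ˢ H.Θ e.1,
        0 < d.v e.1 z - H.avg e.2 (d.v e.2) (z.1, H.R e.1 e.2 z.2.1) := by
  obtain ⟨g, hgC, hg⟩ := H.exists_contDiff_reset_lt hZeno
  have hG : ∀ j, ContDiff ℝ 1 (fun z : ℝ × H.X j × H.Y j => g j z.2.1) := fun j =>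
    (hgC j).comp (contDiff_fst.comp contDiff_snd)
  have hB : ∀ j, ∃ B, ∀ z ∈ H.Ω T j, ‖H.liouvilleOp j (fun z => g j z.2.1) z‖ ≤ B := fun j =>
    (H.isCompact_Ω T j).exists_bound_of_continuousOn (H.continuousOn_liouvilleOp T (hG j))
  choose B hB using hB
  obtain ⟨C, hC⟩ := (Finset.univ.image B).exists_le
  -- `C` bounds the Liouville derivative of every `g j`, and that of time is 1, so the slope `-(C +
  -- 1)` leaves a margin of at least 1.
  let v : ∀ j, ℝ × H.X j × H.Y j → ℝ := fun j =>
    (fun z => g j z.2.1) + (-(C + 1)) • (fun z => z.1)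
  have ht : ∀ j, ContDiff ℝ 1 ((-(C + 1)) • fun z : ℝ × H.X j × H.Y j => z.1) := fun j => by
    change ContDiff ℝ 1 fun z : ℝ × H.X j × H.Y j => -(C + 1) * z.1
    fun_prop
  have hv : ∀ j, ContDiff ℝ 1 (v j) := fun j => (hG j).add (ht j)
  have hvc := fun j => (hv j).continuous
  have hq : ∀ j, ∃ q, ∀ z ∈ XT j ×ˢ H.Θ j, ‖v j (T, z)‖ ≤ q := fun j =>
    ((hXT j).prod (H.isCompact_Θ j)).exists_bound_of_continuousOn
      (by have := hvc j; fun_prop)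
  choose Q hQ using hq
  obtain ⟨q, hq⟩ := (Finset.univ.image Q).exists_le
  refine ⟨⟨v, fun j x => |H.avg j (v j) (0, x) + (q + 1)| + 1, q + 1⟩, hv, fun j => ?_,
    fun j z hz => ?_, fun j z hz => ?_, fun j x => ?_, fun j x => ?_, fun e he z hz => ?_⟩
  · have := continuous_avg (hvc j)
    fun_prop
  · have h1 := hQ j z hz
    have h2 := hq _ (Finset.mem_image_of_mem Q (Finset.mem_univ j))
    have h3 := neg_abs_le (v j (T, z))
    rw [Real.norm_eq_abs] at h1
    change 0 < v j (T, z) + (q + 1)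
    linarith
  · have h1 := hB j z hz
    have h2 := hC _ (Finset.mem_image_of_mem B (Finset.mem_univ j))
    rw [Real.norm_eq_abs] at h1
    have h3 := le_abs_self (H.liouvilleOp j (fun z => g j z.2.1) z)
    have h4 : H.liouvilleOp j (fun z => z.1) z = 1 := by simp [liouvilleOp]
    change 0 < -H.liouvilleOp j (v j) z
    rw [H.liouvilleOp_add (hG j) (ht j), H.liouvilleOp_smul contDiff_fst, h4]
    linarith
  · positivity
  · have := le_abs_self (H.avg j (v j) (0, x) + (q + 1))
    change 0 < |H.avg j (v j) (0, x) + (q + 1)| + 1 - H.avg j (v j) (0, x) - (q + 1)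
    linarith
  · obtain ⟨j, k⟩ := e
    have := H.isProbabilityMeasure_μΘ k
    have h1 : H.avg k (v k) (z.1, H.R j k z.2.1) = v k (z.1, H.R j k z.2.1, 0) := by
      simp [avg, v]
    have h2 := hg j k he z.2.1 hz.2.1
    change 0 < v j z - H.avg k (v k) (z.1, H.R j k z.2.1)
    rw [h1]
    simp only [v, Pi.add_apply, Pi.smul_apply]
    linarith

end QuasiUncertainHybridSystem

/-! ### The dual as a single conic program -/

namespace QuasiUncertainHybridSystem

variable {J : Type*} [Fintype J] [DecidableEq J] (H : QuasiUncertainHybridSystem J)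
  (T : ℝ) (XT : ∀ j, Set (H.X j))

/-- The `C¹` functions on the ambient space of `𝒯 × D_j × Θ_j`. -/
def testFunctions (j : J) : Submodule ℝ (ℝ × H.X j × H.Y j → ℝ) where
  carrier := {v | ContDiff ℝ 1 v}
  add_mem' {v w} (hv : ContDiff ℝ 1 v) (hw : ContDiff ℝ 1 w) := hv.add hw
  zero_mem' := show ContDiff ℝ 1 (fun _ => 0) from contDiff_const
  smul_mem' c v (hv : ContDiff ℝ 1 v) := hv.const_smul c

variable {H} in
theorem contDiff_testFunction {j : J} (v : H.testFunctions j) :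
    ContDiff ℝ 1 (v : ℝ × H.X j × H.Y j → ℝ) := v.2

/-- The functions on the ambient space that are continuous on `D_j`. -/
def slackFunctions (j : J) : Submodule ℝ (H.X j → ℝ) where
  carrier := {w | ContinuousOn w (H.D j)}
  add_mem' {v w} (hv : ContinuousOn v (H.D j)) (hw : ContinuousOn w (H.D j)) := hv.add hw
  zero_mem' := show ContinuousOn (fun _ => 0) (H.D j) from continuousOn_const
  smul_mem' c v (hv : ContinuousOn v (H.D j)) := hv.const_smul c

variable {H} in
theorem continuousOn_slackFunction {j : J} (w : H.slackFunctions j) :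
    ContinuousOn (w : H.X j → ℝ) (H.D j) := w.2

/-- The dual variables satisfying the regularity requirements, as a vector space. -/
abbrev DualSpace : Type _ := (∀ j, H.testFunctions j) × (∀ j, H.slackFunctions j) × ℝ

variable {H} in
/-- The dual variable represented by an element of the dual space. -/
abbrev DualSpace.toVar (d : H.DualSpace) : H.DualVar :=
  ⟨fun j => (d.1 j : ℝ × H.X j × H.Y j → ℝ), fun j => (d.2.1 j : H.X j → ℝ), d.2.2⟩

/-- The terminal constraint. -/
def terminalMap (j : J) : H.DualSpace →ₗ[ℝ] (H.X j × H.Y j → ℝ) where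
  toFun d z := d.toVar.v j (T, z) + d.toVar.q
  map_add' d e := by
    ext z
    change (_ + _) + (_ + _) = (_ + _ : ℝ) + (_ + _)
    ring
  map_smul' c d := by
    ext z
    exact (mul_add c _ _).symm

/-- The flow constraint. -/
def flowMap (j : J) : H.DualSpace →ₗ[ℝ] (ℝ × H.X j × H.Y j → ℝ) where
  toFun d z := -H.liouvilleOp j (d.toVar.v j) z
  map_add' d e := by
    ext z
    have := H.liouvilleOp_add (contDiff_testFunction (d.1 j)) (contDiff_testFunction (e.1 j)) z
    change -H.liouvilleOp j ((d.1 j : ℝ × H.X j × H.Y j → ℝ) + e.1 j) z = -_ + -_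
    rw [this, neg_add]
  map_smul' c d := by
    ext z
    have := H.liouvilleOp_smul (contDiff_testFunction (d.1 j)) c z
    change -H.liouvilleOp j (c • (d.1 j : ℝ × H.X j × H.Y j → ℝ)) z = c * -_
    rw [this, mul_neg]

/-- The nonnegativity constraint on `w`. -/
def slackMap (j : J) : H.DualSpace →ₗ[ℝ] (H.X j → ℝ) where
  toFun d x := d.toVar.w j x
  map_add' _ _ := rfl
  map_smul' _ _ := rfl

/-- The initial constraint. -/
def initialMap (j : J) : H.DualSpace →ₗ[ℝ] (H.X j → ℝ) where
  toFun d x := d.toVar.w j x - H.avg j (d.toVar.v j) (0, x) - d.toVar.q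
  map_add' d e := by
    ext x
    have := avg_add ((contDiff_testFunction (d.1 j)).continuous) ((contDiff_testFunction (e.1 j)).continuous) (0, x)
    change (_ + _) - H.avg j ((d.1 j : ℝ × H.X j × H.Y j → ℝ) + e.1 j) (0, x) - (_ + _) =
      (_ - _ - _) + (_ - _ - _)
    rw [this]
    ring
  map_smul' c d := by
    ext x
    have := avg_smul (H := H) (d.1 j : ℝ × H.X j × H.Y j → ℝ) c (0, x)
    change c * _ - H.avg j (c • (d.1 j : ℝ × H.X j × H.Y j → ℝ)) (0, x) - c * _ = c * (_ - _ - _)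
    rw [this]
    ring

/-- The guard constraint. -/
def guardMap (j k : J) : H.DualSpace →ₗ[ℝ] (ℝ × H.X j × H.Y j → ℝ) where
  toFun d z := d.toVar.v j z - H.avg k (d.toVar.v k) (z.1, H.R j k z.2.1)
  map_add' d e := by
    ext z
    have := avg_add ((contDiff_testFunction (d.1 k)).continuous) ((contDiff_testFunction (e.1 k)).continuous)
      (z.1, H.R j k z.2.1)
    change (_ + _) - H.avg k ((d.1 k : ℝ × H.X k × H.Y k → ℝ) + e.1 k) _ = (_ - _) + (_ - _)
    rw [this]
    ring
  map_smul' c d := by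
    ext z
    have := avg_smul (H := H) (d.1 k : ℝ × H.X k × H.Y k → ℝ) c (z.1, H.R j k z.2.1)
    change c * _ - H.avg k (c • (d.1 k : ℝ × H.X k × H.Y k → ℝ)) _ = c * (_ - _)
    rw [this]
    ring

/-- The objective of the dual program. -/
def objective : H.DualSpace →ₗ[ℝ] ℝ where
  toFun d := ∑ j, ∫ x in H.D j, d.toVar.w j x
  map_add' d e := by
    rw [← Finset.sum_add_distrib]
    refine Finset.sum_congr rfl fun j _ => integral_add ?_ ?_
    · exact (continuousOn_slackFunction (d.2.1 j)).integrableOn_compact (H.isCompact_D j)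
    · exact (continuousOn_slackFunction (e.2.1 j)).integrableOn_compact (H.isCompact_D j)
  map_smul' c d := by
    rw [RingHom.id_apply, smul_eq_mul, Finset.mul_sum]
    exact Finset.sum_congr rfl fun j _ => integral_const_mul _ _

/-- The space of the dual constraint functions. -/
abbrev ConstraintSpace : Type _ :=
  (∀ j, C(XT j ×ˢ H.Θ j, ℝ)) × (∀ j, C(H.Ω T j, ℝ)) × (∀ j, C(H.D j, ℝ)) × (∀ j, C(H.D j, ℝ)) ×
    (∀ e : H.E, C(Icc 0 T ×ˢ H.G e.1.1 e.1.2 ×ˢ H.Θ e.1.1, ℝ))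

/-- All the constraints of the dual program, as one linear map. -/
def constraintMap : H.DualSpace →ₗ[ℝ] H.ConstraintSpace T XT :=
  (LinearMap.pi fun j => restrictContinuous (XT j ×ˢ H.Θ j) (H.terminalMap T j) fun d => by
    have := (contDiff_testFunction (d.1 j)).continuous
    change ContinuousOn (fun z => (d.1 j : ℝ × H.X j × H.Y j → ℝ) (T, z) + d.2.2) _
    fun_prop).prod <|
  (LinearMap.pi fun j => restrictContinuous (H.Ω T j) (H.flowMap j) fun d =>
    (H.continuousOn_liouvilleOp T (contDiff_testFunction (d.1 j))).neg).prod <|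
  (LinearMap.pi fun j => restrictContinuous (H.D j) (H.slackMap j) fun d =>
    continuousOn_slackFunction (d.2.1 j)).prod <|
  (LinearMap.pi fun j => restrictContinuous (H.D j) (H.initialMap j) fun d => by
    have := continuous_avg ((contDiff_testFunction (d.1 j)).continuous)
    refine ContinuousOn.sub (ContinuousOn.sub (continuousOn_slackFunction (d.2.1 j)) ?_) continuousOn_const
    change ContinuousOn (fun x => H.avg j (d.1 j : ℝ × H.X j × H.Y j → ℝ) (0, x)) _
    fun_prop).prod <|
  LinearMap.pi fun e => restrictContinuous _ (H.guardMap e.1.1 e.1.2) fun d =>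
    ((contDiff_testFunction (d.1 e.1.1)).continuous).continuousOn.sub
      (continuousOn_avg_reset e.2 ((contDiff_testFunction (d.1 e.1.2)).continuous))

/-- The right-hand side of the dual constraints. -/
def constraintBound : H.ConstraintSpace T XT := (0, 0, 0, 1, 0)

variable {H T XT}

theorem constraintBound_le_iff (d : H.DualSpace) :
    H.constraintBound T XT ≤ H.constraintMap T XT d ↔ H.DualFeasible T XT d.toVar := by
  constructor
  · rintro ⟨h1, h2, h3, h4, h5⟩
    exact ⟨fun j => (d.1 j).2, fun j => (d.2.1 j).2, fun j x hx => h3 j ⟨x, hx⟩,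
      fun j x hx θ hθ => h1 j ⟨(x, θ), hx, hθ⟩, fun j z hz => h2 j ⟨z, hz⟩,
      fun j x hx => h4 j ⟨x, hx⟩,
      fun j k hjk t ht x hx θ hθ => h5 ⟨(j, k), hjk⟩ ⟨(t, x, θ), ht, hx, hθ⟩⟩
  · intro h
    exact ⟨fun j z => h.terminal j _ z.2.1 _ z.2.2, fun j z => h.flow j _ z.2,
      fun j x => h.w_nonneg j _ x.2, fun j x => h.initial j _ x.2,
      fun e z => h.guard e.1.1 e.1.2 e.2 _ z.2.1 _ z.2.2.1 _ z.2.2.2⟩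

theorem exists_orderUnit (hZeno : H.NoZeno) (hXT : ∀ j, IsCompact (XT j)) :
    ∃ d : H.DualSpace, ∀ y, ∃ c : ℝ, 0 ≤ y + c • H.constraintMap T XT d := by
  obtain ⟨d, hv, hw, h1, h2, h3, h4, h5⟩ := exists_strictly_feasible (T := T) hZeno hXT
  let d' : H.DualSpace := (fun j => ⟨d.v j, hv j⟩, fun j => ⟨d.w j, (hw j).continuousOn⟩, d.q)
  let A := H.constraintMap T XT d'
  refine ⟨d', ?_⟩
  rintro ⟨y1, y2, y3, y4, y5⟩
  have c1 := fun j => isCompact_iff_compactSpace.1 ((hXT j).prod (H.isCompact_Θ j))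
  have c2 := fun j => isCompact_iff_compactSpace.1 (H.isCompact_Ω T j)
  have c3 := fun j => isCompact_iff_compactSpace.1 (H.isCompact_D j)
  have c5 := fun e : H.E => isCompact_iff_compactSpace.1 (H.isCompact_guard T e.2)
  obtain ⟨c, k1, k2, k3, k4, k5⟩ :=
    ((eventually_nonneg_add_smul (g := A.1) (fun j z => h1 j z.1 z.2) y1).and <|
    (eventually_nonneg_add_smul (g := A.2.1) (fun j z => h2 j z.1 z.2) y2).and <|
    (eventually_nonneg_add_smul (g := A.2.2.1) (fun j x => h3 j x.1) y3).and <|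
    (eventually_nonneg_add_smul (g := A.2.2.2.1) (fun j x => h4 j x.1) y4).and <|
    eventually_nonneg_add_smul (g := A.2.2.2.2) (fun e z => h5 e.1 e.2 z.1 z.2) y5).exists
  exact ⟨c, k1, k2, k3, k4, k5⟩

/-- A positive functional on the constraint space is given by measures. -/
theorem exists_supported_eq_pairing (hXT : ∀ j, IsCompact (XT j))
    (Λ : H.ConstraintSpace T XT →ₗ[ℝ] ℝ) (hΛ : ∀ y, 0 ≤ y → 0 ≤ Λ y) :
    ∃ p : H.PrimalVar, p.Supported T XT ∧
      (∀ d : H.DualSpace, Λ (H.constraintMap T XT d) = H.pairing T p d.toVar) ∧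
      Λ (H.constraintBound T XT) = ∑ j, ∫ _x, (1 : ℝ) ∂(p.μ0 j) := by
  obtain ⟨μ1, m1, i1⟩ := exists_mem_MPlus_sum_integral_eq
    (fun j => (hXT j).prod (H.isCompact_Θ j)) (Λ ∘ₗ LinearMap.inl ℝ _ _)
    fun y hy => hΛ _ ⟨hy, le_rfl⟩
  obtain ⟨μ2, m2, i2⟩ := exists_mem_MPlus_sum_integral_eq
    (fun j => H.isCompact_Ω T j) (Λ ∘ₗ LinearMap.inr ℝ _ _ ∘ₗ LinearMap.inl ℝ _ _)
    fun y hy => hΛ _ ⟨le_rfl, hy, le_rfl⟩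
  obtain ⟨μ3, m3, i3⟩ := exists_mem_MPlus_sum_integral_eq H.isCompact_D
    (Λ ∘ₗ LinearMap.inr ℝ _ _ ∘ₗ LinearMap.inr ℝ _ _ ∘ₗ LinearMap.inl ℝ _ _)
    fun y hy => hΛ _ ⟨le_rfl, le_rfl, hy, le_rfl⟩
  obtain ⟨μ4, m4, i4⟩ := exists_mem_MPlus_sum_integral_eq H.isCompact_D
    (Λ ∘ₗ LinearMap.inr ℝ _ _ ∘ₗ LinearMap.inr ℝ _ _ ∘ₗ LinearMap.inr ℝ _ _ ∘ₗ
      LinearMap.inl ℝ _ _)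
    fun y hy => hΛ _ ⟨le_rfl, le_rfl, le_rfl, hy, le_rfl⟩
  obtain ⟨μ5, m5, i5⟩ := exists_mem_MPlus_sum_integral_eq
    (fun e : H.E => H.isCompact_guard T e.2)
    (Λ ∘ₗ LinearMap.inr ℝ _ _ ∘ₗ LinearMap.inr ℝ _ _ ∘ₗ LinearMap.inr ℝ _ _ ∘ₗ
      LinearMap.inr ℝ _ _)
    fun y hy => hΛ _ ⟨le_rfl, le_rfl, le_rfl, le_rfl, hy⟩
  -- The representing measures are matched to the primal variables block by block: terminal, flow,
  -- slack, initial, guard.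
  refine ⟨⟨μ2, μ4, μ1, μ3, fun j k => if h : (j, k) ∈ H.E then μ5 ⟨(j, k), h⟩ else 0⟩,
    ⟨m2, m4, m1, m3, fun j k h => ?_⟩, fun d => ?_, ?_⟩
  · simp only [h, dite_true]
    exact m5 ⟨(j, k), h⟩
  · have e1 := i1 (H.constraintMap T XT d).1 (fun j => H.terminalMap T j d) fun _ _ => rfl
    have e2 := i2 (H.constraintMap T XT d).2.1 (fun j => H.flowMap j d) fun _ _ => rfl
    have e3 := i3 (H.constraintMap T XT d).2.2.1 (fun j => H.slackMap j d) fun _ _ => rfl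
    have e4 := i4 (H.constraintMap T XT d).2.2.2.1 (fun j => H.initialMap j d) fun _ _ => rfl
    have e5 := i5 (H.constraintMap T XT d).2.2.2.2 (fun e => H.guardMap e.1.1 e.1.2 d)
      fun _ _ => rfl
    simp only [LinearMap.comp_apply, LinearMap.inl_apply, LinearMap.inr_apply] at e1 e2 e3 e4 e5
    have hsplit : ∀ y : H.ConstraintSpace T XT, Λ y = Λ (y.1, 0) + Λ (0, y.2.1, 0) +
        Λ (0, 0, y.2.2.1, 0) + Λ (0, 0, 0, y.2.2.2.1, 0) + Λ (0, 0, 0, 0, y.2.2.2.2) := by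
      intro y
      simp only [← map_add]
      congr 1
      simp
    rw [hsplit, e1, e2, e3, e4, e5, pairing]
    congr 1
    rw [← Finset.sum_coe_sort H.E]
    refine Finset.sum_congr rfl fun e _ => ?_
    simp only [Prod.mk.eta, e.2, dite_true]
    rfl
  -- The right-hand side is nonzero only in the initial block, whose measures are the `μ0 j`.
  · have e4 := i4 1 (fun _ _ => 1) fun _ _ => rfl
    exact e4

/-- Measures whose pairing with all dual variables is the dual objective are primal feasible. -/
theorem primalFeasible_of_pairing_eq (hXT : ∀ j, IsCompact (XT j)) {p : H.PrimalVar}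
    (hp : p.Supported T XT) (h : ∀ d : H.DualSpace, H.pairing T p d.toVar = H.objective d) :
    H.PrimalFeasible T XT p := by
  have key := fun d : H.DualSpace =>
    (pairing_eq hXT hp (d := d.toVar) (fun j => (d.1 j).2) (fun j => (d.2.1 j).2)).symm.trans (h d)
  have hlz : ∀ j, H.liouvilleOp j 0 = 0 := fun j => by
    ext z
    simp [liouvilleOp]
  refine ⟨hp.mem_μ, hp.mem_μ0, hp.mem_μT, hp.mem_μ0hat, hp.mem_μG, fun j v hv => ?_,
    fun j => ?_, ?_⟩
  -- Varying only `v` in mode `j` isolates the Liouville equation of that mode.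
  · have hk := key (Pi.single j ⟨v, hv⟩, 0, 0)
    rw [Finset.sum_eq_single j] at hk
    · simp [objective] at hk
      linarith
    · intro i _ hij
      simp [hij, hlz]
    · simp
  · have := (hp.mem_μ0 j).1
    have := (hp.mem_μ0hat j).1
    have : IsFiniteMeasure (volume.restrict (H.D j)) :=
      ⟨by simpa using (H.isCompact_D j).measure_lt_top⟩
    refine ext_of_forall_integral_eq_of_IsFiniteMeasure fun u => ?_
    -- Varying only `w` in mode `j` over bounded continuous functions identifies two finite
    -- measures.
    have hk := key (0, Pi.single j ⟨u, u.continuous.continuousOn⟩, 0)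
    rw [integral_add_measure (u.integrable _) (u.integrable _)]
    have hs : ∀ F : ∀ i, (H.X i → ℝ) → ℝ, (∀ i, F i 0 = 0) →
        ∑ i, F i ((Pi.single j ⟨u, u.continuous.continuousOn⟩ : ∀ i, H.slackFunctions i) i :) =
          F j u := by
      intro F hF
      rw [Finset.sum_eq_single j]
      · simp
      · intro i _ hij
        simp [hij, hF]
      · simp
    have hl := hs (fun i w => ∫ x, w x ∂(p.μ0 i) + ∫ x, w x ∂(p.μ0hat i)) (by simp)
    have hr := hs (fun i w => ∫ x in H.D i, w x) (by simp)
    simp only [objective, LinearMap.coe_mk, AddHom.coe_mk] at hk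
    rw [hr, hl] at hk
    simpa [hlz] using hk
  -- Varying only `q` gives the mass balance.
  · have hk := key (0, 0, 1)
    simp [objective, hlz] at hk
    simpa using sub_eq_zero.1 hk

end QuasiUncertainHybridSystem

end

/-! ### Absence of a duality gap -/

theorem mainTheorem5 {J : Type*} [Fintype J] [DecidableEq J] (H : QuasiUncertainHybridSystem J)
    (hZeno : H.NoZeno) (T : ℝ) (hT : 0 < T) (XT : ∀ j, Set (H.X j))
    (hXT_compact : ∀ j, IsCompact (XT j)) (hXT_subset : ∀ j, XT j ⊆ H.D j)
    (hXT_guard : ∀ j k, (j, k) ∈ H.E → Disjoint (XT j) (H.G j k)) :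
    ∃ c : ℝ, H.primalValue T XT = (c : EReal) ∧ H.dualValue T XT = (c : EReal) := by
  obtain ⟨d₀, hd₀⟩ := QuasiUncertainHybridSystem.exists_orderUnit (T := T) hZeno hXT_compact
  have hne : ∃ d, H.constraintBound T XT ≤ H.constraintMap T XT d := by
    -- A multiple of the Slater point dominates the right-hand side, so the dual is feasible.
    obtain ⟨c, hc⟩ := hd₀ (-H.constraintBound T XT)
    exact ⟨c • d₀, by rwa [map_smul, ← sub_nonneg, sub_eq_neg_add]⟩
  have hbdd : BddBelow (H.objective '' {d | H.constraintBound T XT ≤ H.constraintMap T XT d}) := by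
    refine ⟨0, ?_⟩
    rintro _ ⟨d, hd, rfl⟩
    exact Finset.sum_nonneg fun j _ => setIntegral_nonneg (H.isCompact_D j).measurableSet
      fun x hx => ((QuasiUncertainHybridSystem.constraintBound_le_iff d).1 hd).w_nonneg j x hx
  obtain ⟨c, hglb⟩ : ∃ c, IsGLB
      (H.objective '' {d | H.constraintBound T XT ≤ H.constraintMap T XT d}) c :=
    Real.exists_isGLB (Set.Nonempty.image H.objective hne) hbdd
  obtain ⟨Λ, hΛ, hΛA, hΛb⟩ := exists_positive_dual_of_isGLB _ _ _ d₀ hd₀ hne hglb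
  obtain ⟨p, hp, hpA, hpb⟩ :=
    QuasiUncertainHybridSystem.exists_supported_eq_pairing hXT_compact Λ hΛ
  have hfeas : H.PrimalFeasible T XT p :=
    QuasiUncertainHybridSystem.primalFeasible_of_pairing_eq hXT_compact hp fun d => by
      rw [← hpA, hΛA]
  -- The measures obtained from `Λ` attain the dual infimum `c` in the primal.
  have h1 : (c : EReal) ≤ H.primalValue T XT := by
    rw [← hΛb, hpb]
    exact le_iSup₂_of_le p hfeas le_rfl
  have h2 : H.primalValue T XT ≤ H.dualValue T XT :=
    iSup₂_le fun p hp => le_iInf₂ fun d hd =>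
      EReal.coe_le_coe_iff.2 (QuasiUncertainHybridSystem.weak_duality hXT_compact hp hd)
  have h3 : H.dualValue T XT ≤ c := by
    by_contra! hlt
    obtain ⟨r, hcr, hr⟩ := EReal.lt_iff_exists_real_btwn.1 hlt
    obtain ⟨_, ⟨d, hd, rfl⟩, hdr⟩ := (isGLB_lt_iff hglb).1 (EReal.coe_lt_coe_iff.1 hcr)
    have h4 : H.dualValue T XT ≤ (H.objective d : EReal) :=
      iInf₂_le d.toVar ((QuasiUncertainHybridSystem.constraintBound_le_iff d).1 hd)
    exact absurd (hr.trans_le h4) (not_lt.2 (EReal.coe_le_coe_iff.2 hdr.le))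
  exact ⟨c, le_antisymm (h2.trans h3) h1, le_antisymm h3 (h1.trans h2)⟩
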